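/- Let $M=(M,\phi,\xi,\eta,g)$ be a smooth contact metric manifold of dimension $2n+1$: $\phi$ is a $(1,1)$-tensor field, $\xi$ a vector field, $\eta$ a $1$-form and $g$ a Riemannian metric, all smooth, with $\phi^2X=-X+\eta(X)\xi$, $\phi\xi=0$, $\eta\circ\phi=0$, $\eta(\xi)=1$, $g(\phi X,\phi Y)=g(X,Y)-\eta(X)\eta(Y)$, $\eta(X)=g(\xi,X)$, $\eta\wedge(d\eta)^n\neq0$ everywhere, and $d\eta(X,Y)=g(X,\phi Y)$, where $d\eta(X,Y)=\frac12\big(X\eta(Y)-Y\eta(X)-\eta([X,Y])\big)$. Let $\nabla$ be the Levi-Civita connection of $g$ and $R(X,Y)Z=[\nabla_X,\nabla_Y]Z-\nabla_{[X,Y]}Z$ its curvature tensor. In any local coordinates $(x^1,\dots,x^{2n+1})$ of $M$, write $\partial_i=\partial/\partial x^i$, $g_{ij}=g(\partial_i,\partial_j)$, $(g^{ij})=(g_{ij})^{-1}$, $R_{ijkl}=g(R(\partial_i,\partial_j)\partial_k,\partial_l)$, $\phi\partial_i={\phi_i}^a\partial_a$, $\phi_{ij}=g(\phi\partial_i,\partial_j)$,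 $\eta_i=\eta(\partial_i)$, $\xi=\xi^a\partial_a$, $\nabla^a=g^{ab}\nabla_b$, with summation over repeated indices. Then, at every point and for all indices $i,j,k,l$, \begin{align*} &R_{ijkl}+{\phi_i}^a{\phi_j}^b{\phi_k}^c{\phi_l}^dR_{abcd}+{\phi_i}^a{\phi_k}^cR_{ajcl}+{\phi_j}^b{\phi_l}^dR_{ibkd}-{\phi_i}^a{\phi_j}^bR_{abkl}\\ &\quad-{\phi_k}^c{\phi_l}^dR_{ijcd}+{\phi_i}^a{\phi_l}^dR_{ajkd}+{\phi_j}^b{\phi_k}^cR_{ibcl}+4\phi_{il}\phi_{jk}-4\phi_{jl}\phi_{ik}\\ &\quad-4g_{il}g_{jk}+4g_{jl}g_{ik}+4g_{il}\eta_j\eta_k+4g_{jk}\eta_i\eta_l-4g_{jl}\eta_i\eta_k-4g_{ik}\eta_j\eta_l\\ &=2(\nabla^a\phi_{ij})\nabla_a\phi_{kl}+2\eta_k\nabla_l\phi_{ij}-2\eta_l\nabla_k\phi_{ij}+2\eta_i\nabla_j\phi_{kl}-2\eta_j\nabla_i\phi_{kl}, \end{align*} \begin{align*} &\xi^a{\phi_j}^b{\phi_k}^c{\phi_l}^dR_{abcd}+\xi^a{\phi_k}^cR_{ajcl}-\xi^a{\phi_j}^bR_{abkl}+\xi^a{\phi_l}^dR_{ajkd}\\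 &=2(\nabla^a\eta_j)\nabla_a\phi_{kl}+2\eta_k\nabla_l\eta_j-2\eta_l\nabla_k\eta_j+2\phi_{aj}\nabla^a\phi_{kl}, \end{align*} and \begin{equation*} {\phi_i}^a\xi^b{\phi_k}^c\xi^dR_{abcd}+\xi^b\xi^dR_{ibkd}=2\big((\nabla_a\eta_i)\nabla^a\eta_k+\phi_{ak}\nabla^a\eta_i+\phi_{ai}\nabla^a\eta_k\big). \end{equation*} -/

import Mathlib

open Bundle
open scoped Manifold ContDiff

noncomputable section

/-! ### Tensor calculus in local coordinates

`Coord m` is the model space `ℝ ^ m`. A tensor field written in local coordinates is a family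
of real functions on `Coord m`, indexed by its tensor indices. Throughout, `g i j` are the
components of a Riemannian metric, `θ j` those of a 1-form and `t i j` those of a tensor field
of type (0,2). -/

/-- The coordinate space `ℝ ^ m`. -/
abbrev Coord (m : ℕ) : Type := EuclideanSpace ℝ (Fin m)

namespace Coord

variable {m : ℕ}

/-- The partial derivative `∂ᵢ f` of a function at the point `y`. -/
def partialDeriv (i : Fin m) (f : Coord m → ℝ) (y : Coord m) : ℝ :=
  fderiv ℝ f y (EuclideanSpace.single i 1)

/-- The components `g^{ij}` of the inverse matrix of `(g_{ij})`. -/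
def metricInv (g : Fin m → Fin m → Coord m → ℝ) (i j : Fin m) (y : Coord m) : ℝ :=
  (Matrix.of fun a b => g a b y)⁻¹ i j

/-- The Christoffel symbols of the Levi-Civita connection of `g`,
`∇_{∂ᵢ} ∂ⱼ = ∑ₖ Γᵏᵢⱼ ∂ₖ`, with
`Γᵏᵢⱼ = 1/2 ∑ₗ g^{kl} (∂ᵢ g_{jl} + ∂ⱼ g_{il} - ∂ₗ g_{ij})`;
it is written `christoffel g k i j`. -/
def christoffel (g : Fin m → Fin m → Coord m → ℝ) (k i j : Fin m) (y : Coord m) : ℝ :=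
  (1 / 2 : ℝ) * ∑ l, metricInv g k l y *
    (partialDeriv i (g j l) y + partialDeriv j (g i l) y - partialDeriv l (g i j) y)

/-- The components `R_{ijk}^l` of the curvature tensor
`R(X, Y)Z = ∇_X ∇_Y Z - ∇_Y ∇_X Z - ∇_{[X, Y]} Z`, that is
`R(∂ᵢ, ∂ⱼ)∂ₖ = ∑ₗ R_{ijk}^l ∂ₗ`. -/
def curvatureUp (g : Fin m → Fin m → Coord m → ℝ) (i j k l : Fin m) (y : Coord m) : ℝ :=
  partialDeriv i (christoffel g l j k) y - partialDeriv j (christoffel g l i k) y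
    + ∑ a, (christoffel g l i a y * christoffel g a j k y
      - christoffel g l j a y * christoffel g a i k y)

/-- The components `R_{ijkl} = g(R(∂ᵢ, ∂ⱼ)∂ₖ, ∂ₗ) = ∑_d g_{dl} R_{ijk}^d`
of the curvature tensor of type (0,4). -/
def curvature (g : Fin m → Fin m → Coord m → ℝ) (i j k l : Fin m) (y : Coord m) : ℝ :=
  ∑ d, g d l y * curvatureUp g i j k d y

/-- The components `∇ₐ θⱼ` of the covariant derivative of a 1-form. -/
def covDerivOne (g : Fin m → Fin m → Coord m → ℝ) (θ : Fin m → Coord m → ℝ)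
    (a j : Fin m) (y : Coord m) : ℝ :=
  partialDeriv a (θ j) y - ∑ b, christoffel g b a j y * θ b y

/-- The components `∇ₐ t_{ij}` of the covariant derivative of a tensor of type (0,2). -/
def covDerivTwo (g : Fin m → Fin m → Coord m → ℝ) (t : Fin m → Fin m → Coord m → ℝ)
    (a i j : Fin m) (y : Coord m) : ℝ :=
  partialDeriv a (t i j) y - ∑ b, christoffel g b a i y * t b j y
    - ∑ b, christoffel g b a j y * t i b y

/-- The components `(dθ)(∂ᵢ, ∂ⱼ)` of the exterior derivative of a 1-form, with the normalization
`dθ(X, Y) = 1/2 (X θ(Y) - Y θ(X) - θ([X, Y]))` of contact metric geometry. -/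
def extDerivOne (θ : Fin m → Coord m → ℝ) (i j : Fin m) (y : Coord m) : ℝ :=
  (1 / 2 : ℝ) * (partialDeriv i (θ j) y - partialDeriv j (θ i) y)

/-- Up to a positive factor that depends only on `n`, the component
`(θ ∧ (dθ)ⁿ)(∂₁, …, ∂_{2n+1})` of the top degree form `θ ∧ (dθ)ⁿ`. -/
def contactVolume {n : ℕ} (θ : Fin (2 * n + 1) → Coord (2 * n + 1) → ℝ)
    (y : Coord (2 * n + 1)) : ℝ :=
  ∑ σ : Equiv.Perm (Fin (2 * n + 1)), ((Equiv.Perm.sign σ : ℤ) : ℝ) *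
    (θ (σ 0) y * ∏ k : Fin n,
      extDerivOne θ (σ ⟨2 * (k : ℕ) + 1, by omega⟩) (σ ⟨2 * (k : ℕ) + 2, by omega⟩) y)

end Coord

/-! ### Almost contact metric structures and contact metric structures -/

/-- A smooth almost contact metric structure `(φ, ξ, η, g)` on a smooth manifold `M` of dimension
`2n + 1`: a (1,1)-tensor field `φ`, a vector field `ξ`, a 1-form `η` and a Riemannian metric `g`,
all smooth, with the usual algebraic identities. -/
structure AlmostContactMetricStructure (n : ℕ) (M : Type*) [TopologicalSpace M]
    [ChartedSpace (Coord (2 * n + 1)) M] [IsManifold (𝓡 (2 * n + 1)) ∞ M] where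
  /-- The structure tensor. -/
  φ : ∀ p : M, TangentSpace (𝓡 (2 * n + 1)) p →L[ℝ] TangentSpace (𝓡 (2 * n + 1)) p
  /-- The characteristic vector field. -/
  ξ : ∀ p : M, TangentSpace (𝓡 (2 * n + 1)) p
  /-- The 1-form. -/
  η : ∀ p : M, TangentSpace (𝓡 (2 * n + 1)) p →L[ℝ] ℝ
  /-- The smooth Riemannian metric. -/
  g : ContMDiffRiemannianMetric (𝓡 (2 * n + 1)) ∞ (Coord (2 * n + 1))
    (fun p : M => TangentSpace (𝓡 (2 * n + 1)) p)
  φ_smooth : ContMDiff (𝓡 (2 * n + 1))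
    ((𝓡 (2 * n + 1)).prod 𝓘(ℝ, Coord (2 * n + 1) →L[ℝ] Coord (2 * n + 1))) ∞
    (fun p => TotalSpace.mk' (Coord (2 * n + 1) →L[ℝ] Coord (2 * n + 1))
      (E := fun p : M => TangentSpace (𝓡 (2 * n + 1)) p →L[ℝ] TangentSpace (𝓡 (2 * n + 1)) p)
      p (φ p))
  ξ_smooth : ContMDiff (𝓡 (2 * n + 1)) ((𝓡 (2 * n + 1)).prod 𝓘(ℝ, Coord (2 * n + 1))) ∞
    (fun p => TotalSpace.mk' (Coord (2 * n + 1))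
      (E := fun p : M => TangentSpace (𝓡 (2 * n + 1)) p) p (ξ p))
  η_smooth : ContMDiff (𝓡 (2 * n + 1))
    ((𝓡 (2 * n + 1)).prod 𝓘(ℝ, Coord (2 * n + 1) →L[ℝ] ℝ)) ∞
    (fun p => TotalSpace.mk' (Coord (2 * n + 1) →L[ℝ] ℝ)
      (E := fun p : M => TangentSpace (𝓡 (2 * n + 1)) p →L[ℝ] Trivial M ℝ p)
      p (η p))
  φ_φ : ∀ (p : M) (X : TangentSpace (𝓡 (2 * n + 1)) p), φ p (φ p X) = -X + η p X • ξ p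
  φ_ξ : ∀ p : M, φ p (ξ p) = 0
  η_φ : ∀ (p : M) (X : TangentSpace (𝓡 (2 * n + 1)) p), η p (φ p X) = 0
  η_ξ : ∀ p : M, η p (ξ p) = 1
  g_φ_φ : ∀ (p : M) (X Y : TangentSpace (𝓡 (2 * n + 1)) p),
    g.inner p (φ p X) (φ p Y) = g.inner p X Y - η p X * η p Y
  g_ξ : ∀ (p : M) (X : TangentSpace (𝓡 (2 * n + 1)) p), η p X = g.inner p (ξ p) X

namespace AlmostContactMetricStructure

variable {n : ℕ} {M : Type*} [TopologicalSpace M]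
  [ChartedSpace (Coord (2 * n + 1)) M] [IsManifold (𝓡 (2 * n + 1)) ∞ M]

/-- The coordinate vector `∂ᵢ` of the chart `e` at the point of `M` with coordinates `y`. -/
def coordVec (e : OpenPartialHomeomorph M (Coord (2 * n + 1))) (i : Fin (2 * n + 1))
    (y : Coord (2 * n + 1)) : TangentSpace (𝓡 (2 * n + 1)) (e.symm y) :=
  mfderiv 𝓘(ℝ, Coord (2 * n + 1)) (𝓡 (2 * n + 1)) e.symm y (EuclideanSpace.single i (1 : ℝ))

/-- The `i`-th component `dxⁱ(v)` of a tangent vector `v` in the chart `e`. -/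
def coordComp (e : OpenPartialHomeomorph M (Coord (2 * n + 1))) (i : Fin (2 * n + 1))
    {p : M} (v : TangentSpace (𝓡 (2 * n + 1)) p) : ℝ :=
  (show Coord (2 * n + 1) from
    mfderiv (𝓡 (2 * n + 1)) 𝓘(ℝ, Coord (2 * n + 1)) e p v) i

variable (S : AlmostContactMetricStructure n M) (e : OpenPartialHomeomorph M (Coord (2 * n + 1)))

/-- `g_{ij} = g(∂ᵢ, ∂ⱼ)`. -/
def gLow (i j : Fin (2 * n + 1)) (y : Coord (2 * n + 1)) : ℝ :=
  S.g.inner (e.symm y) (coordVec e i y) (coordVec e j y)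

/-- `ηᵢ = η(∂ᵢ)`. -/
def ηLow (i : Fin (2 * n + 1)) (y : Coord (2 * n + 1)) : ℝ :=
  S.η (e.symm y) (coordVec e i y)

/-- `φ_{ij} = g(φ ∂ᵢ, ∂ⱼ)`. -/
def φLow (i j : Fin (2 * n + 1)) (y : Coord (2 * n + 1)) : ℝ :=
  S.g.inner (e.symm y) (S.φ (e.symm y) (coordVec e i y)) (coordVec e j y)

/-- `φᵢᵃ`, where `φ ∂ᵢ = ∑ₐ φᵢᵃ ∂ₐ`. -/
def φUp (i a : Fin (2 * n + 1)) (y : Coord (2 * n + 1)) : ℝ :=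
  coordComp e a (S.φ (e.symm y) (coordVec e i y))

/-- `ξᵃ`, where `ξ = ∑ₐ ξᵃ ∂ₐ`. -/
def ξUp (a : Fin (2 * n + 1)) (y : Coord (2 * n + 1)) : ℝ :=
  coordComp e a (S.ξ (e.symm y))

/-- `g^{ij}`, the inverse matrix of `(g_{ij})`. -/
def gUp (i j : Fin (2 * n + 1)) (y : Coord (2 * n + 1)) : ℝ :=
  Coord.metricInv (S.gLow e) i j y

/-- `R_{ijkl} = g(R(∂ᵢ, ∂ⱼ)∂ₖ, ∂ₗ)`, the curvature tensor of the Levi-Civita connection of `g`. -/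
def R (i j k l : Fin (2 * n + 1)) (y : Coord (2 * n + 1)) : ℝ :=
  Coord.curvature (S.gLow e) i j k l y

/-- `∇ₐ φ_{ij}`. -/
def nablaφ (a i j : Fin (2 * n + 1)) (y : Coord (2 * n + 1)) : ℝ :=
  Coord.covDerivTwo (S.gLow e) (S.φLow e) a i j y

/-- `∇ₐ ηⱼ`. -/
def nablaη (a j : Fin (2 * n + 1)) (y : Coord (2 * n + 1)) : ℝ :=
  Coord.covDerivOne (S.gLow e) (S.ηLow e) a j y

/-- `∇ᵃ φ_{ij} = ∑_b g^{ab} ∇_b φ_{ij}`. -/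
def nablaUpφ (a i j : Fin (2 * n + 1)) (y : Coord (2 * n + 1)) : ℝ :=
  ∑ b, S.gUp e a b y * S.nablaφ e b i j y

/-- `∇ᵃ ηⱼ = ∑_b g^{ab} ∇_b ηⱼ`. -/
def nablaUpη (a j : Fin (2 * n + 1)) (y : Coord (2 * n + 1)) : ℝ :=
  ∑ b, S.gUp e a b y * S.nablaη e b j y

/-- The almost contact metric structure `(φ, ξ, η, g)` is a contact metric structure: `η` is a
contact form, `η ∧ (dη)ⁿ ≠ 0` everywhere, and `dη(X, Y) = g(X, φ Y)`. Both conditions are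
written in all the local coordinate systems of the smooth manifold. -/
structure IsContactMetric : Prop where
  contact : ∀ e ∈ IsManifold.maximalAtlas (𝓡 (2 * n + 1)) ∞ M, ∀ y ∈ e.target,
    Coord.contactVolume (S.ηLow e) y ≠ 0
  dη_eq : ∀ e ∈ IsManifold.maximalAtlas (𝓡 (2 * n + 1)) ∞ M, ∀ y ∈ e.target,
    ∀ i j : Fin (2 * n + 1), Coord.extDerivOne (S.ηLow e) i j y =
      S.g.inner (e.symm y) (coordVec e i y) (S.φ (e.symm y) (coordVec e j y))

end AlmostContactMetricStructure

end

/-!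
The cone `r² g + dr²` over a contact metric manifold, with the almost complex structure that
rotates the radial field into `ξ` and restricts to `φ` on the contact distribution, is almost
Kähler: its fundamental form is closed because `dη = g(·, φ ·)`. The curvature of an almost Kähler
manifold satisfies Gray's identity, in which the only other term is quadratic in the derivative of
the almost complex structure. The three formulas are that identity on the cone at `r = 1`, with
none, one or two of its arguments radial.
-/

set_option maxSynthPendingDepth 3

/-- The values at a point of an almost Kähler metric `g`, of its almost complex structure `J` and
of the covariant derivative `t X Y = (∇_X J) Y`, with the relations between them; `t_cyc` says that
the fundamental 2-form `g X (J Y)` is closed. The metric may be indefinite. -/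
structure IsAlmostKahlerJet {E : Type*} [NormedAddCommGroup E] [NormedSpace ℝ E]
    (g : E →L[ℝ] E →L[ℝ] ℝ) (J : E →L[ℝ] E) (t : E →L[ℝ] E →L[ℝ] E) : Prop where
  symm : ∀ X Y, g X Y = g Y X
  nondegenerate : ∀ X, (∀ Y, g X Y = 0) → X = 0
  J_J : ∀ X, J (J X) = -X
  skew : ∀ X Y, g (J X) Y = -g X (J Y)
  t_skew : ∀ X Y Z, g (t X Y) Z = -g (t X Z) Y
  t_cyc : ∀ X Y Z, g (t X Y) Z + g (t Y Z) X + g (t Z X) Y = 0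
  t_J : ∀ X Y, t X (J Y) = -J (t X Y)

namespace IsAlmostKahlerJet

variable {E : Type*} [NormedAddCommGroup E] [NormedSpace ℝ E]
  {g : E →L[ℝ] E →L[ℝ] ℝ} {J : E →L[ℝ] E} {t : E →L[ℝ] E →L[ℝ] E}

theorem ext_left (h : IsAlmostKahlerJet g J t) {X Y : E} (H : ∀ Z, g X Z = g Y Z) : X = Y :=
  sub_eq_zero.1 <| h.nondegenerate _ fun Z => by simp [H]

theorem g_J_J (h : IsAlmostKahlerJet g J t) (X Y : E) : g (J X) (J Y) = g X Y := by
  simp [h.skew, h.J_J]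

theorem g_t (h : IsAlmostKahlerJet g J t) (X Y Z : E) :
    g (t X Y) Z = g X (t Z Y - t Y Z) := by
  have := h.t_cyc X Y Z
  rw [map_sub, h.symm X, h.symm X, h.t_skew Z Y X]
  linarith

theorem g_t_J (h : IsAlmostKahlerJet g J t) (X Y Z : E) :
    g (t X (J Y)) Z = g (t X Y) (J Z) := by
  rw [h.t_J, map_neg, neg_apply, h.skew, neg_neg]

-- The defect `B X Y Z` of the identity is invariant under cyclic permutations by `t_cyc`, and
-- changes sign when `J` is moved from the first to the second slot; together these force `B = 0`.
theorem t_J_left (h : IsAlmostKahlerJet g J t) (X Y : E) : t (J X) Y = -J (t X Y) := by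
  let B (X Y Z : E) : ℝ := g (t (J X) Y) Z - g (t X (J Y)) Z
  have B_cyc (X Y Z : E) : B X Y Z = B Y Z X := by
    have h₁ := h.t_cyc (J X) Y Z
    have h₂ := h.t_cyc X (J Y) Z
    simp only [B, h.g_t_J] at *
    linarith
  have B_J (X Y Z : E) : B (J X) Y Z = -B X (J Y) Z := by
    simp only [B, h.J_J, map_neg, neg_apply]
    ring
  have B_J_right (X Y Z : E) : B X (J Y) Z = B X Y (J Z) := by
    simp only [B, h.g_t_J]
  have B_J_eq_zero (X Y Z : E) : B (J X) Y Z = 0 := by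
    have : B (J X) Y Z = -B (J X) Y Z := calc
      B (J X) Y Z = B Y (J Z) X := by rw [B_cyc, B_J_right]
      _ = -B Z (J X) Y := by rw [B_cyc, B_J]
      _ = -B (J X) Y Z := by rw [B_cyc]
    linarith
  refine h.ext_left fun Z => ?_
  have : B X Y Z = 0 := by simpa [B, h.J_J] using B_J_eq_zero (-J X) Y Z
  rw [← h.t_J]
  exact sub_eq_zero.1 this

end IsAlmostKahlerJet

/-- An almost Kähler jet with the second covariant derivative `D X Y Z = (∇²_{X,Y} J) Z` and the
curvature operator `R X Y Z`: the derivative of the quasi-Kähler identity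
`(∇_{JX} J) Y = -J (∇_X J) Y`, and the Ricci identity for `J`. -/
structure IsAlmostKahlerTwoJet {E : Type*} [NormedAddCommGroup E] [NormedSpace ℝ E]
    (g : E →L[ℝ] E →L[ℝ] ℝ) (J : E →L[ℝ] E) (t : E →L[ℝ] E →L[ℝ] E)
    (D R : E → E → E → E) : Prop extends IsAlmostKahlerJet g J t where
  D_J : ∀ X Y Z, D X (J Y) Z + t (t X Y) Z + t X (t Y Z) + J (D X Y Z) = 0
  ricci : ∀ X Y Z, D X Y Z - D Y X Z = R X Y (J Z) - J (R X Y Z)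

namespace IsAlmostKahlerTwoJet

variable {E : Type*} [NormedAddCommGroup E] [NormedSpace ℝ E]
  {g : E →L[ℝ] E →L[ℝ] ℝ} {J : E →L[ℝ] E} {t : E →L[ℝ] E →L[ℝ] E} {D R : E → E → E → E}

theorem g_D_J (h : IsAlmostKahlerTwoJet g J t D R) (X Y Z W : E) :
    g (D X (J Y) Z) W + g (t (t X Y) Z) W + g (t X (t Y Z)) W - g (D X Y Z) (J W) = 0 := by
  have := congrArg (g · W) (h.D_J X Y Z)
  simpa [h.skew, ← sub_eq_add_neg] using this

theorem g_D_add (h : IsAlmostKahlerTwoJet g J t D R) (X Y Z W : E) :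
    g (D X (J Y) Z) W - g (D X Y Z) (J W) + g (D (J X) Y Z) W + g (D (J X) (J Y) Z) (J W)
      = -2 * g (t (t X Y) Z) W := by
  have hX := h.g_D_J X Y Z W
  have hJX := h.g_D_J (J X) Y Z (J W)
  simp only [h.t_J_left, map_neg, neg_apply, h.g_J_J, h.J_J] at hJX
  linarith

theorem g_ricci (h : IsAlmostKahlerTwoJet g J t D R) (X Y Z W : E) :
    g (D X Y Z) W - g (D Y X Z) W = g (R X Y (J Z)) W + g (R X Y Z) (J W) := by
  have := congrArg (g · W) (h.ricci X Y Z)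
  simpa [h.skew] using this

/-- Gray's curvature identity of an almost Kähler metric. -/
theorem curvature_identity (h : IsAlmostKahlerTwoJet g J t D R) (X Y Z W : E) :
    g (R X Y Z) W + g (R (J X) (J Y) (J Z)) (J W) + g (R (J X) Y (J Z)) W + g (R X (J Y) Z) (J W)
      - g (R (J X) (J Y) Z) W - g (R X Y (J Z)) (J W) + g (R (J X) Y Z) (J W)
      + g (R X (J Y) (J Z)) W
      = 2 * g (t Y X - t X Y) (t W Z - t Z W) := by
  have hXY := h.g_D_add X Y Z W
  have hYX := h.g_D_add Y X Z W
  have r₁ := h.g_ricci X Y Z (J W)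
  have r₂ := h.g_ricci (J X) (J Y) Z (J W)
  have r₃ := h.g_ricci (J X) Y Z W
  have r₄ := h.g_ricci X (J Y) Z W
  simp only [h.J_J, map_neg] at r₁ r₂
  have ht := h.g_t (t Y X - t X Y) Z W
  rw [map_sub t, sub_apply, map_sub g, sub_apply] at ht
  linarith

end IsAlmostKahlerTwoJet

section CovariantDerivative

variable {E : Type*} [NormedAddCommGroup E] [NormedSpace ℝ E]

/-- The covariant derivative `X ↦ ∇_X V` of a vector field on an open subset of a vector space, for
the connection `∇_X V = D_X V + Γ(X, V)`. -/
noncomputable def covVec (Γ : E → E →L[ℝ] E →L[ℝ] E) (V : E → E) (y : E) : E →L[ℝ] E :=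
  fderiv ℝ V y + (Γ y).flip (V y)

/-- The covariant derivative `X ↦ ∇_X φ` of a field of endomorphisms. -/
noncomputable def covEnd (Γ : E → E →L[ℝ] E →L[ℝ] E) (φ : E → E →L[ℝ] E) (y : E) :
    E →L[ℝ] E →L[ℝ] E :=
  fderiv ℝ φ y + ((ContinuousLinearMap.compL ℝ E E E).flip (φ y)
    - ContinuousLinearMap.compL ℝ E E E (φ y)) ∘L Γ y

/-- The covariant derivative `(∇_m t)(X, Y)` of a field of vector-valued bilinear maps. -/
noncomputable def covBilin (Γ : E → E →L[ℝ] E →L[ℝ] E) (t : E → E →L[ℝ] E →L[ℝ] E)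
    (y m X Y : E) : E :=
  fderiv ℝ t y m X Y + Γ y m (t y X Y) - t y (Γ y m X) Y - t y X (Γ y m Y)

/-- The curvature operator `R(X, Y)Z = ∇_X ∇_Y Z - ∇_Y ∇_X Z - ∇_{[X, Y]} Z`. -/
noncomputable def curv (Γ : E → E →L[ℝ] E →L[ℝ] E) (y : E) : E →L[ℝ] E →L[ℝ] E →L[ℝ] E :=
  let A := fderiv ℝ Γ y + (ContinuousLinearMap.compL ℝ E E E).bilinearComp (Γ y) (Γ y)
  A - A.flip

variable {F G : Type*} [NormedAddCommGroup F] [NormedSpace ℝ F] [NormedAddCommGroup G]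
  [NormedSpace ℝ G] {Γ : E → E →L[ℝ] E →L[ℝ] E} {g : E → E →L[ℝ] E →L[ℝ] ℝ}
  {φ : E → E →L[ℝ] E} {t : E → E →L[ℝ] E →L[ℝ] E} {V W : E → E} {y : E}

theorem covVec_apply (Γ : E → E →L[ℝ] E →L[ℝ] E) (V : E → E) (y X : E) :
    covVec Γ V y X = fderiv ℝ V y X + Γ y X (V y) := rfl

theorem covEnd_apply (Γ : E → E →L[ℝ] E →L[ℝ] E) (φ : E → E →L[ℝ] E) (y X Y : E) :
    covEnd Γ φ y X Y = fderiv ℝ φ y X Y + Γ y X (φ y Y) - φ y (Γ y X Y) := by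
  simp [covEnd, add_sub_assoc]

theorem curv_apply (Γ : E → E →L[ℝ] E →L[ℝ] E) (y X Y Z : E) :
    curv Γ y X Y Z =
      fderiv ℝ Γ y X Y Z - fderiv ℝ Γ y Y X Z + Γ y X (Γ y Y Z) - Γ y Y (Γ y X Z) := by
  simp only [curv, sub_apply, add_apply, ContinuousLinearMap.flip_apply,
    ContinuousLinearMap.bilinearComp_apply, ContinuousLinearMap.compL_apply,
    ContinuousLinearMap.comp_apply]
  abel

@[simp] theorem covVec_const (Γ : E → E →L[ℝ] E →L[ℝ] E) (Y y X : E) :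
    covVec Γ (fun _ => Y) y X = Γ y X Y := by
  simp [covVec_apply]

theorem covVec_neg (Γ : E → E →L[ℝ] E →L[ℝ] E) (V : E → E) (y X : E) :
    covVec Γ (fun z => -V z) y X = -covVec Γ V y X := by
  simp only [covVec_apply, fderiv_fun_neg, neg_apply, map_neg, neg_add]

theorem covVec_congr (h : V =ᶠ[nhds y] W) : covVec Γ V y = covVec Γ W y := by
  rw [covVec, covVec, h.fderiv_eq, h.eq_of_nhds]

theorem fderiv_clm_apply_const {T : E → F →L[ℝ] G} (hT : DifferentiableAt ℝ T y) (m : E) (X : F) :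
    fderiv ℝ (fun z => T z X) y m = fderiv ℝ T y m X := by
  simp [fderiv_clm_apply hT (differentiableAt_const X)]

theorem fderiv_clm_apply_apply_const {H : Type*} [NormedAddCommGroup H] [NormedSpace ℝ H]
    {T : E → F →L[ℝ] G →L[ℝ] H} (hT : DifferentiableAt ℝ T y) (m : E) (X : F) (Y : G) :
    fderiv ℝ (fun z => T z X Y) y m = fderiv ℝ T y m X Y := by
  rw [fderiv_clm_apply_const (hT.clm_apply (differentiableAt_const X)), fderiv_clm_apply_const hT]

theorem covVec_endo (hφ : DifferentiableAt ℝ φ y) (hV : DifferentiableAt ℝ V y) (m : E) :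
    covVec Γ (fun z => φ z (V z)) y m = covEnd Γ φ y m (V y) + φ y (covVec Γ V y m) := by
  simp only [covVec_apply, covEnd_apply, fderiv_clm_apply hφ hV, add_apply, map_add,
    ContinuousLinearMap.comp_apply, ContinuousLinearMap.flip_apply]
  abel

theorem covVec_bilin (ht : DifferentiableAt ℝ t y) (hV : DifferentiableAt ℝ V y)
    (hW : DifferentiableAt ℝ W y) (m : E) :
    covVec Γ (fun z => t z (V z) (W z)) y m = covBilin Γ t y m (V y) (W y)
      + t y (covVec Γ V y m) (W y) + t y (V y) (covVec Γ W y m) := by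
  simp only [covVec_apply, covBilin, fderiv_clm_apply (ht.clm_apply hV) hW,
    fderiv_clm_apply ht hV, add_apply, map_add, ContinuousLinearMap.comp_apply,
    ContinuousLinearMap.flip_apply]
  abel

theorem fderiv_metric_apply (hg : DifferentiableAt ℝ g y)
    (hΓ : ∀ m X Y, fderiv ℝ g y m X Y = g y (Γ y m X) Y + g y X (Γ y m Y))
    (hV : DifferentiableAt ℝ V y) (hW : DifferentiableAt ℝ W y) (m : E) :
    fderiv ℝ (fun z => g z (V z) (W z)) y m =
      g y (covVec Γ V y m) (W y) + g y (V y) (covVec Γ W y m) := by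
  simp only [covVec_apply, fderiv_clm_apply (hg.clm_apply hV) hW, fderiv_clm_apply hg hV,
    add_apply, map_add, ContinuousLinearMap.comp_apply, ContinuousLinearMap.flip_apply, hΓ]
  abel

theorem differentiableAt_fderiv {T : E → F} (hT : ContDiffAt ℝ ∞ T y) :
    DifferentiableAt ℝ (fderiv ℝ T) y :=
  (hT.fderiv_right (m := ∞) (by simp)).differentiableAt (by simp)

theorem fderiv_fderiv_comm {T : E → F} (hT : ContDiffAt ℝ ∞ T y) (X Y : E) :
    fderiv ℝ (fderiv ℝ T) y X Y = fderiv ℝ (fderiv ℝ T) y Y X :=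
  hT.isSymmSndFDerivAt (by simpa using WithTop.coe_le_coe.2 (le_top : (2 : ℕ∞) ≤ ⊤)) X Y

theorem contDiffAt_covEnd (hφ : ContDiffAt ℝ ∞ φ y) (hΓ : ContDiffAt ℝ ∞ Γ y) :
    ContDiffAt ℝ ∞ (covEnd Γ φ) y := by
  have : ContDiffAt ℝ ∞ (fderiv ℝ φ) y := hφ.fderiv_right (by simp)
  unfold covEnd
  fun_prop

theorem fderiv_covEnd (hφ : ContDiffAt ℝ ∞ φ y) (hΓ : ContDiffAt ℝ ∞ Γ y) (X Y Z : E) :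
    fderiv ℝ (covEnd Γ φ) y X Y Z =
      fderiv ℝ (fderiv ℝ φ) y X Y Z + fderiv ℝ Γ y X Y (φ y Z) + Γ y Y (fderiv ℝ φ y X Z)
        - fderiv ℝ φ y X (Γ y Y Z) - φ y (fderiv ℝ Γ y X Y Z) := by
  have hφ' := differentiableAt_fderiv hφ
  have hφ₁ := hφ.differentiableAt (by simp)
  have hΓ₁ := hΓ.differentiableAt (by simp)
  have hΓφ : fderiv ℝ (fun z => Γ z Y (φ z Z)) y X =
      fderiv ℝ Γ y X Y (φ y Z) + Γ y Y (fderiv ℝ φ y X Z) := by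
    rw [fderiv_clm_apply (by fun_prop) (by fun_prop), add_comm]
    simp [fderiv_clm_apply_const, hφ₁, hΓ₁]
  have hφΓ : fderiv ℝ (fun z => φ z (Γ z Y Z)) y X =
      fderiv ℝ φ y X (Γ y Y Z) + φ y (fderiv ℝ Γ y X Y Z) := by
    rw [fderiv_clm_apply hφ₁ (by fun_prop), add_comm]
    simp [fderiv_clm_apply_apply_const, hΓ₁]
  rw [← fderiv_clm_apply_apply_const ((contDiffAt_covEnd hφ hΓ).differentiableAt (by simp))]
  simp only [covEnd_apply]
  rw [fderiv_fun_sub (by fun_prop) (by fun_prop), fderiv_fun_add (by fun_prop) (by fun_prop),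
    sub_apply, add_apply, hΓφ, hφΓ, fderiv_clm_apply_apply_const hφ']
  abel

/-- The Ricci identity for a field of endomorphisms. -/
theorem covBilin_covEnd_sub (hφ : ContDiffAt ℝ ∞ φ y) (hΓ : ContDiffAt ℝ ∞ Γ y)
    (hΓ_symm : ∀ X Y, Γ y X Y = Γ y Y X) (X Y Z : E) :
    covBilin Γ (covEnd Γ φ) y X Y Z - covBilin Γ (covEnd Γ φ) y Y X Z =
      curv Γ y X Y (φ y Z) - φ y (curv Γ y X Y Z) := by
  simp only [covBilin, fderiv_covEnd hφ hΓ, fderiv_fderiv_comm hφ X Y, covEnd_apply, curv_apply,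
    map_add, map_sub, hΓ_symm Y X]
  abel

end CovariantDerivative

/-- An almost Kähler structure on an open subset `U` of a vector space: a metric `g`, possibly
indefinite, with its Levi-Civita connection `Γ` and an almost complex structure `J` for which the
2-form `g X (J Y)` is closed. -/
structure IsAlmostKahlerOn {E : Type*} [NormedAddCommGroup E] [NormedSpace ℝ E] (U : Set E)
    (g : E → E →L[ℝ] E →L[ℝ] ℝ) (Γ : E → E →L[ℝ] E →L[ℝ] E) (J : E → E →L[ℝ] E) : Prop where
  isOpen : IsOpen U
  contDiffOn_g : ContDiffOn ℝ ∞ g U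
  contDiffOn_Γ : ContDiffOn ℝ ∞ Γ U
  contDiffOn_J : ContDiffOn ℝ ∞ J U
  symm : ∀ y ∈ U, ∀ X Y, g y X Y = g y Y X
  nondegenerate : ∀ y ∈ U, ∀ X, (∀ Y, g y X Y = 0) → X = 0
  Γ_symm : ∀ y ∈ U, ∀ X Y, Γ y X Y = Γ y Y X
  Γ_metric : ∀ y ∈ U, ∀ m X Y, fderiv ℝ g y m X Y = g y (Γ y m X) Y + g y X (Γ y m Y)
  J_J : ∀ y ∈ U, ∀ X, J y (J y X) = -X
  skew : ∀ y ∈ U, ∀ X Y, g y (J y X) Y = -g y X (J y Y)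
  closed : ∀ y ∈ U, ∀ X Y Z, fderiv ℝ (fun z => g z Y (J z Z)) y X
    + fderiv ℝ (fun z => g z Z (J z X)) y Y + fderiv ℝ (fun z => g z X (J z Y)) y Z = 0

namespace IsAlmostKahlerOn

variable {E : Type*} [NormedAddCommGroup E] [NormedSpace ℝ E] {U : Set E}
  {g : E → E →L[ℝ] E →L[ℝ] ℝ} {Γ : E → E →L[ℝ] E →L[ℝ] E} {J : E → E →L[ℝ] E} {y : E}

theorem differentiableAt_g (h : IsAlmostKahlerOn U g Γ J) (hy : y ∈ U) : DifferentiableAt ℝ g y :=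
  (h.contDiffOn_g.contDiffAt (h.isOpen.mem_nhds hy)).differentiableAt (by simp)

theorem contDiffAt_Γ (h : IsAlmostKahlerOn U g Γ J) (hy : y ∈ U) : ContDiffAt ℝ ∞ Γ y :=
  h.contDiffOn_Γ.contDiffAt (h.isOpen.mem_nhds hy)

theorem contDiffAt_J (h : IsAlmostKahlerOn U g Γ J) (hy : y ∈ U) : ContDiffAt ℝ ∞ J y :=
  h.contDiffOn_J.contDiffAt (h.isOpen.mem_nhds hy)

theorem differentiableAt_J (h : IsAlmostKahlerOn U g Γ J) (hy : y ∈ U) : DifferentiableAt ℝ J y :=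
  (h.contDiffAt_J hy).differentiableAt (by simp)

theorem fderiv_g_J (h : IsAlmostKahlerOn U g Γ J) (hy : y ∈ U) (m X Y : E) :
    fderiv ℝ (fun z => g z X (J z Y)) y m =
      g y (Γ y m X) (J y Y) + g y X (covEnd Γ J y m Y + J y (Γ y m Y)) := by
  have hJ := h.differentiableAt_J hy
  rw [fderiv_metric_apply (h.differentiableAt_g hy) (h.Γ_metric y hy) (by fun_prop) (by fun_prop),
    covVec_endo hJ (by fun_prop), covVec_const, covVec_const]

theorem g_J_comm (h : IsAlmostKahlerOn U g Γ J) (hy : y ∈ U) (X Y : E) :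
    g y X (J y Y) = -g y Y (J y X) := by
  rw [h.symm y hy, h.skew y hy]

theorem covEnd_skew (h : IsAlmostKahlerOn U g Γ J) (hy : y ∈ U) (X Y Z : E) :
    g y (covEnd Γ J y X Y) Z = -g y (covEnd Γ J y X Z) Y := by
  have hcomm : (fun z => g z Y (J z Z)) =ᶠ[nhds y] fun z => -g z Z (J z Y) := by
    filter_upwards [h.isOpen.mem_nhds hy] with z hz using h.g_J_comm hz Y Z
  have hderiv := DFunLike.congr_fun (hcomm.fderiv_eq (𝕜 := ℝ)) X
  rw [fderiv_fun_neg, neg_apply, h.fderiv_g_J hy, h.fderiv_g_J hy, map_add, map_add] at hderiv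
  have hY := h.g_J_comm hy (Γ y X Y) Z
  have hZ := h.g_J_comm hy (Γ y X Z) Y
  rw [h.symm y hy (covEnd Γ J y X Y), h.symm y hy (covEnd Γ J y X Z)]
  linarith

theorem covEnd_cyclic (h : IsAlmostKahlerOn U g Γ J) (hy : y ∈ U) (X Y Z : E) :
    g y (covEnd Γ J y X Y) Z + g y (covEnd Γ J y Y Z) X + g y (covEnd Γ J y Z X) Y = 0 := by
  have hclosed := h.closed y hy X Z Y
  simp only [h.fderiv_g_J hy, map_add] at hclosed
  rw [h.Γ_symm y hy Y X, h.Γ_symm y hy Z X, h.Γ_symm y hy Z Y] at hclosed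
  have hXY := h.g_J_comm hy (Γ y X Y) Z
  have hXZ := h.g_J_comm hy (Γ y X Z) Y
  have hYZ := h.g_J_comm hy (Γ y Y Z) X
  simp only [h.symm y hy (covEnd Γ J y _ _)]
  linarith

theorem covEnd_J (h : IsAlmostKahlerOn U g Γ J) (hy : y ∈ U) (X Y : E) :
    covEnd Γ J y X (J y Y) = -J y (covEnd Γ J y X Y) := by
  have hJ := h.differentiableAt_J hy
  have hJJ : (fun z => J z (J z Y)) =ᶠ[nhds y] fun _ => -Y := by
    filter_upwards [h.isOpen.mem_nhds hy] with z hz using h.J_J z hz Y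
  have hcov := DFunLike.congr_fun (covVec_congr (Γ := Γ) hJJ) X
  rw [covVec_endo hJ (by fun_prop), covVec_endo hJ (by fun_prop), covVec_const, covVec_const,
    map_add, h.J_J y hy, map_neg, ← add_assoc, add_eq_right] at hcov
  exact eq_neg_of_add_eq_zero_left hcov

theorem isAlmostKahlerJet (h : IsAlmostKahlerOn U g Γ J) (hy : y ∈ U) :
    IsAlmostKahlerJet (g y) (J y) (covEnd Γ J y) where
  symm := h.symm y hy
  nondegenerate := h.nondegenerate y hy
  J_J := h.J_J y hy
  skew := h.skew y hy
  t_skew := h.covEnd_skew hy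
  t_cyc := h.covEnd_cyclic hy
  t_J := h.covEnd_J hy

theorem covBilin_covEnd_J (h : IsAlmostKahlerOn U g Γ J) (hy : y ∈ U) (X Y Z : E) :
    covBilin Γ (covEnd Γ J) y X (J y Y) Z + covEnd Γ J y (covEnd Γ J y X Y) Z
      + covEnd Γ J y X (covEnd Γ J y Y Z) + J y (covBilin Γ (covEnd Γ J) y X Y Z) = 0 := by
  have hJ := h.differentiableAt_J hy
  have ht : DifferentiableAt ℝ (covEnd Γ J) y :=
    (contDiffAt_covEnd (h.contDiffAt_J hy) (h.contDiffAt_Γ hy)).differentiableAt (by simp)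
  have hJ_left : (fun z => covEnd Γ J z (J z Y) Z) =ᶠ[nhds y] fun z => -J z (covEnd Γ J z Y Z) := by
    filter_upwards [h.isOpen.mem_nhds hy] with z hz using (h.isAlmostKahlerJet hz).t_J_left Y Z
  have hcov := DFunLike.congr_fun (covVec_congr (Γ := Γ) hJ_left) X
  rw [covVec_neg, covVec_bilin ht (by fun_prop) (by fun_prop), covVec_endo hJ (by fun_prop),
    covVec_endo hJ (by fun_prop), covVec_bilin ht (by fun_prop) (by fun_prop)] at hcov
  simp only [covVec_const, map_add, add_apply, (h.isAlmostKahlerJet hy).t_J_left] at hcov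
  rw [← sub_eq_zero] at hcov
  rw [← hcov]
  abel

theorem isAlmostKahlerTwoJet (h : IsAlmostKahlerOn U g Γ J) (hy : y ∈ U) :
    IsAlmostKahlerTwoJet (g y) (J y) (covEnd Γ J y) (covBilin Γ (covEnd Γ J) y)
      (fun X Y => curv Γ y X Y) where
  toIsAlmostKahlerJet := h.isAlmostKahlerJet hy
  D_J := h.covBilin_covEnd_J hy
  ricci := covBilin_covEnd_sub (h.contDiffAt_J hy) (h.contDiffAt_Γ hy) (h.Γ_symm y hy)

end IsAlmostKahlerOn

theorem fderiv_extDeriv_cyclic {E : Type*} [NormedAddCommGroup E] [NormedSpace ℝ E]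
    {α : E → E →L[ℝ] ℝ} {y : E} (hα : ContDiffAt ℝ ∞ α y) (X Y Z : E) :
    fderiv ℝ (fun z => fderiv ℝ α z Y Z - fderiv ℝ α z Z Y) y X
      + fderiv ℝ (fun z => fderiv ℝ α z Z X - fderiv ℝ α z X Z) y Y
      + fderiv ℝ (fun z => fderiv ℝ α z X Y - fderiv ℝ α z Y X) y Z = 0 := by
  have hα' := differentiableAt_fderiv hα
  have hsub (X Y Z : E) : fderiv ℝ (fun z => fderiv ℝ α z Y Z - fderiv ℝ α z Z Y) y X =
      fderiv ℝ (fderiv ℝ α) y X Y Z - fderiv ℝ (fderiv ℝ α) y X Z Y := by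
    rw [fderiv_fun_sub (by fun_prop) (by fun_prop), sub_apply,
      fderiv_clm_apply_apply_const hα', fderiv_clm_apply_apply_const hα']
  rw [hsub, hsub, hsub, fderiv_fderiv_comm hα Y X, fderiv_fderiv_comm hα Z X,
    fderiv_fderiv_comm hα Z Y]
  ring

/-- A contact metric structure with contact form `g ξ` on an open subset `U` of a vector space; `Γ`
is the Levi-Civita connection of the metric `g`, which may be indefinite. -/
structure IsContactMetricOn {E : Type*} [NormedAddCommGroup E] [NormedSpace ℝ E] (U : Set E)
    (g : E → E →L[ℝ] E →L[ℝ] ℝ) (Γ : E → E →L[ℝ] E →L[ℝ] E) (φ : E → E →L[ℝ] E) (ξ : E → E) :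
    Prop where
  isOpen : IsOpen U
  contDiffOn_g : ContDiffOn ℝ ∞ g U
  contDiffOn_Γ : ContDiffOn ℝ ∞ Γ U
  contDiffOn_φ : ContDiffOn ℝ ∞ φ U
  contDiffOn_ξ : ContDiffOn ℝ ∞ ξ U
  symm : ∀ y ∈ U, ∀ X Y, g y X Y = g y Y X
  nondegenerate : ∀ y ∈ U, ∀ X, (∀ Y, g y X Y = 0) → X = 0
  Γ_symm : ∀ y ∈ U, ∀ X Y, Γ y X Y = Γ y Y X
  Γ_metric : ∀ y ∈ U, ∀ m X Y, fderiv ℝ g y m X Y = g y (Γ y m X) Y + g y X (Γ y m Y)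
  φ_φ : ∀ y ∈ U, ∀ X, φ y (φ y X) = -X + g y (ξ y) X • ξ y
  φ_ξ : ∀ y ∈ U, φ y (ξ y) = 0
  ξ_ξ : ∀ y ∈ U, g y (ξ y) (ξ y) = 1
  skew : ∀ y ∈ U, ∀ X Y, g y (φ y X) Y = -g y X (φ y Y)
  dη : ∀ y ∈ U, ∀ X Y, fderiv ℝ (fun z => g z (ξ z) Y) y X - fderiv ℝ (fun z => g z (ξ z) X) y Y
    = 2 * g y X (φ y Y)

section Cone

variable {E F : Type*} [NormedAddCommGroup E] [NormedSpace ℝ E] [NormedAddCommGroup F]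
  [NormedSpace ℝ F]

open ContinuousLinearMap in
/-- The pullback of a bilinear map on `E` to the cone `E × ℝ` over `E`, with its values mapped by
`ι`; it builds the cone metric and its connection by smooth operations. -/
noncomputable def coneLift {F' : Type*} [NormedAddCommGroup F'] [NormedSpace ℝ F']
    (ι : F →L[ℝ] F') : (E →L[ℝ] E →L[ℝ] F) →L[ℝ] E × ℝ →L[ℝ] E × ℝ →L[ℝ] F' :=
  (compL ℝ (E × ℝ) E (E × ℝ →L[ℝ] F')).flip (fst ℝ E ℝ) ∘L
    compL ℝ E (E →L[ℝ] F) (E × ℝ →L[ℝ] F')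
      ((compL ℝ (E × ℝ) E F').flip (fst ℝ E ℝ) ∘L compL ℝ E F F' ι)

theorem coneLift_apply {F' : Type*} [NormedAddCommGroup F'] [NormedSpace ℝ F'] (ι : F →L[ℝ] F')
    (b : E →L[ℝ] E →L[ℝ] F) (A B : E × ℝ) : coneLift ι b A B = ι (b A.1 B.1) := rfl

/-- The cone metric `r² g + dr²` at the point `(y, r)` of `E × ℝ`. -/
noncomputable def coneMetric (g : E → E →L[ℝ] E →L[ℝ] ℝ) (p : E × ℝ) :
    E × ℝ →L[ℝ] E × ℝ →L[ℝ] ℝ :=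
  p.2 ^ 2 • coneLift (.id ℝ ℝ) (g p.1)
    + (ContinuousLinearMap.snd ℝ E ℝ).smulRight (ContinuousLinearMap.snd ℝ E ℝ)

open ContinuousLinearMap in
/-- The Levi-Civita connection of the cone metric. -/
noncomputable def coneConn (g : E → E →L[ℝ] E →L[ℝ] ℝ) (Γ : E → E →L[ℝ] E →L[ℝ] E) (p : E × ℝ) :
    E × ℝ →L[ℝ] E × ℝ →L[ℝ] E × ℝ :=
  let S : E × ℝ →L[ℝ] E × ℝ →L[ℝ] E × ℝ := (snd ℝ E ℝ).smulRight (inl ℝ E ℝ ∘L fst ℝ E ℝ)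
  coneLift (inl ℝ E ℝ) (Γ p.1) + p.2⁻¹ • (S + S.flip) - p.2 • coneLift (inr ℝ E ℝ) (g p.1)

open ContinuousLinearMap in
/-- The almost complex structure on the cone, which maps `r ∂_r` to `-ξ` and agrees with `φ` on the
kernel of the contact form. -/
noncomputable def coneJ (g : E → E →L[ℝ] E →L[ℝ] ℝ) (φ : E → E →L[ℝ] E) (ξ : E → E) (p : E × ℝ) :
    E × ℝ →L[ℝ] E × ℝ :=
  inl ℝ E ℝ ∘L φ p.1 ∘L fst ℝ E ℝ - p.2⁻¹ • (snd ℝ E ℝ).smulRight (inl ℝ E ℝ (ξ p.1))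
    + p.2 • inr ℝ E ℝ ∘L g p.1 (ξ p.1) ∘L fst ℝ E ℝ

/-- The primitive `r² η` of twice the fundamental 2-form of the cone, where `η = g ξ`. -/
noncomputable def coneForm (g : E → E →L[ℝ] E →L[ℝ] ℝ) (ξ : E → E) (p : E × ℝ) : E × ℝ →L[ℝ] ℝ :=
  p.2 ^ 2 • g p.1 (ξ p.1) ∘L ContinuousLinearMap.fst ℝ E ℝ

variable {U : Set E} {g : E → E →L[ℝ] E →L[ℝ] ℝ} {Γ : E → E →L[ℝ] E →L[ℝ] E} {φ : E → E →L[ℝ] E}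
  {ξ : E → E}

theorem coneMetric_apply (g : E → E →L[ℝ] E →L[ℝ] ℝ) (p A B : E × ℝ) :
    coneMetric g p A B = p.2 ^ 2 * g p.1 A.1 B.1 + A.2 * B.2 := rfl

theorem coneConn_apply (g : E → E →L[ℝ] E →L[ℝ] ℝ) (Γ : E → E →L[ℝ] E →L[ℝ] E) (p A B : E × ℝ) :
    coneConn g Γ p A B =
      (Γ p.1 A.1 B.1 + p.2⁻¹ • (A.2 • B.1 + B.2 • A.1), -(p.2 * g p.1 A.1 B.1)) := by
  ext <;> simp [coneConn, coneLift_apply]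

theorem coneJ_apply (g : E → E →L[ℝ] E →L[ℝ] ℝ) (φ : E → E →L[ℝ] E) (ξ : E → E) (p A : E × ℝ) :
    coneJ g φ ξ p A = (φ p.1 A.1 - p.2⁻¹ • A.2 • ξ p.1, p.2 * g p.1 (ξ p.1) A.1) := by
  ext <;> simp [coneJ]

theorem contDiffOn_comp_fst {T : E → F} (hT : ContDiffOn ℝ ∞ T U) :
    ContDiffOn ℝ ∞ (fun p : E × ℝ => T p.1) (U ×ˢ Set.Ioi 0) :=
  hT.comp contDiffOn_fst fun _ hp => hp.1

theorem contDiffOn_inv_snd : ContDiffOn ℝ ∞ (fun p : E × ℝ => p.2⁻¹) (U ×ˢ Set.Ioi 0) :=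
  contDiffOn_snd.inv fun _ hp => hp.2.ne'

theorem contDiffOn_coneLift {F' : Type*} [NormedAddCommGroup F'] [NormedSpace ℝ F'] (ι : F →L[ℝ] F')
    {b : E → E →L[ℝ] E →L[ℝ] F} (hb : ContDiffOn ℝ ∞ b U) :
    ContDiffOn ℝ ∞ (fun p : E × ℝ => coneLift ι (b p.1)) (U ×ˢ Set.Ioi 0) :=
  (contDiffOn_comp_fst hb).continuousLinearMap_comp (coneLift (E := E) ι)

theorem contDiffOn_coneMetric (hg : ContDiffOn ℝ ∞ g U) :
    ContDiffOn ℝ ∞ (coneMetric g) (U ×ˢ Set.Ioi 0) := by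
  have hg' := contDiffOn_coneLift (.id ℝ ℝ) hg
  unfold coneMetric
  fun_prop

theorem contDiffOn_coneConn (hg : ContDiffOn ℝ ∞ g U) (hΓ : ContDiffOn ℝ ∞ Γ U) :
    ContDiffOn ℝ ∞ (coneConn g Γ) (U ×ˢ Set.Ioi 0) := by
  have hg' := contDiffOn_coneLift (.inr ℝ E ℝ) hg
  have hΓ' := contDiffOn_coneLift (.inl ℝ E ℝ) hΓ
  have hr := contDiffOn_inv_snd (U := U)
  unfold coneConn
  fun_prop

theorem contDiffOn_coneJ (hg : ContDiffOn ℝ ∞ g U) (hφ : ContDiffOn ℝ ∞ φ U)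
    (hξ : ContDiffOn ℝ ∞ ξ U) : ContDiffOn ℝ ∞ (coneJ g φ ξ) (U ×ˢ Set.Ioi 0) := by
  have hη := (contDiffOn_comp_fst hg).clm_apply (contDiffOn_comp_fst hξ)
  exact ((contDiffOn_const.clm_comp <| (contDiffOn_comp_fst hφ).clm_comp contDiffOn_const).sub <|
    contDiffOn_inv_snd.smul <| contDiffOn_const.smulRight <|
      contDiffOn_const.clm_apply (contDiffOn_comp_fst hξ)).add <|
    contDiffOn_snd.smul <| contDiffOn_const.clm_comp <| hη.clm_comp contDiffOn_const

variable {p : E × ℝ}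

theorem fderiv_comp_fst {T : E → F} (hT : DifferentiableAt ℝ T p.1) (A : E × ℝ) :
    fderiv ℝ (fun q : E × ℝ => T q.1) p A = fderiv ℝ T p.1 A.1 :=
  DFunLike.congr_fun (hT.hasFDerivAt.comp p hasFDerivAt_fst).fderiv A

theorem fderiv_inv_snd (hp : p.2 ≠ 0) (A : E × ℝ) :
    fderiv ℝ (fun q : E × ℝ => q.2⁻¹) p A = -(p.2 ^ 2)⁻¹ * A.2 := by
  have hsnd : HasFDerivAt (fun q : E × ℝ => q.2) (.snd ℝ E ℝ) p := hasFDerivAt_snd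
  exact (DFunLike.congr_fun ((hasDerivAt_inv hp).comp_hasFDerivAt p hsnd).fderiv A).trans (by simp)

theorem fderiv_coneLift {F' : Type*} [NormedAddCommGroup F'] [NormedSpace ℝ F'] (ι : F →L[ℝ] F')
    {b : E → E →L[ℝ] E →L[ℝ] F} (hb : DifferentiableAt ℝ b p.1) (A : E × ℝ) :
    fderiv ℝ (fun q : E × ℝ => coneLift ι (b q.1)) p A = coneLift ι (fderiv ℝ b p.1 A.1) :=
  DFunLike.congr_fun
    ((coneLift (E := E) ι).hasFDerivAt.comp p (hb.hasFDerivAt.comp p hasFDerivAt_fst)).fderiv A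

theorem fderiv_coneMetric (hg : DifferentiableAt ℝ g p.1) (A B C : E × ℝ) :
    fderiv ℝ (coneMetric g) p A B C =
      p.2 ^ 2 * fderiv ℝ g p.1 A.1 B.1 C.1 + 2 * p.2 * A.2 * g p.1 B.1 C.1 := by
  unfold coneMetric
  rw [fderiv_add_const, fderiv_fun_smul (by fun_prop) (by fun_prop), fderiv_fun_pow _ (by fun_prop)]
  simp [fderiv_coneLift, hg, fderiv_snd, coneLift_apply]

theorem fderiv_coneConn (hg : DifferentiableAt ℝ g p.1) (hΓ : DifferentiableAt ℝ Γ p.1)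
    (hp : p.2 ≠ 0) (A B C : E × ℝ) :
    fderiv ℝ (coneConn g Γ) p A B C =
      (fderiv ℝ Γ p.1 A.1 B.1 C.1 - ((p.2 ^ 2)⁻¹ * A.2) • (B.2 • C.1 + C.2 • B.1),
        -(A.2 * g p.1 B.1 C.1 + p.2 * fderiv ℝ g p.1 A.1 B.1 C.1)) := by
  have : DifferentiableAt ℝ (fun q : E × ℝ => q.2⁻¹) p := differentiableAt_snd.inv hp
  unfold coneConn
  rw [fderiv_fun_sub (by fun_prop) (by fun_prop), fderiv_fun_add (by fun_prop) (by fun_prop),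
    fderiv_fun_smul (by fun_prop) (by fun_prop), fderiv_fun_smul (by fun_prop) (by fun_prop)]
  simp only [add_apply, sub_apply, smul_apply, zero_apply, ContinuousLinearMap.smulRight_apply,
    ContinuousLinearMap.comp_apply, ContinuousLinearMap.flip_apply, ContinuousLinearMap.inl_apply,
    ContinuousLinearMap.inr_apply, ContinuousLinearMap.coe_fst', ContinuousLinearMap.coe_snd',
    fderiv_fun_const, Pi.zero_apply, fderiv_snd, fderiv_coneLift _ hg, fderiv_coneLift _ hΓ,
    fderiv_inv_snd hp, coneLift_apply]
  ext
  · simp only [Prod.fst_add, Prod.fst_sub, Prod.smul_fst, Prod.fst_zero]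
    match_scalars <;> ring
  · simp only [Prod.snd_add, Prod.snd_sub, Prod.smul_snd, Prod.snd_zero, smul_eq_mul]
    ring

theorem fderiv_coneJ (hg : DifferentiableAt ℝ g p.1) (hφ : DifferentiableAt ℝ φ p.1)
    (hξ : DifferentiableAt ℝ ξ p.1) (hp : p.2 ≠ 0) (A B : E × ℝ) :
    fderiv ℝ (coneJ g φ ξ) p A B =
      (fderiv ℝ φ p.1 A.1 B.1 + ((p.2 ^ 2)⁻¹ * A.2 * B.2) • ξ p.1
          - p.2⁻¹ • B.2 • fderiv ℝ ξ p.1 A.1,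
        A.2 * g p.1 (ξ p.1) B.1 + p.2 * fderiv ℝ (fun z => g z (ξ z) B.1) p.1 A.1) := by
  have hr : DifferentiableAt ℝ (fun q : E × ℝ => q.2⁻¹) p := differentiableAt_snd.inv hp
  have hJ : DifferentiableAt ℝ (coneJ g φ ξ) p := by
    unfold coneJ
    fun_prop
  rw [← fderiv_clm_apply_const hJ]
  have hφB : fderiv ℝ (fun q : E × ℝ => φ q.1 B.1) p A = fderiv ℝ φ p.1 A.1 B.1 := by
    rw [fderiv_clm_apply_const (by fun_prop), fderiv_comp_fst hφ]
  have hηB : fderiv ℝ (fun q : E × ℝ => g q.1 (ξ q.1) B.1) p A =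
      fderiv ℝ (fun z => g z (ξ z) B.1) p.1 A.1 :=
    fderiv_comp_fst (T := fun z => g z (ξ z) B.1) (by fun_prop) A
  have hξB : fderiv ℝ (fun q : E × ℝ => B.2 • ξ q.1) p A = B.2 • fderiv ℝ ξ p.1 A.1 := by
    rw [fderiv_fun_const_smul (by fun_prop), smul_apply, fderiv_comp_fst hξ]
  simp only [coneJ_apply]
  rw [DifferentiableAt.fderiv_prodMk (by fun_prop) (by fun_prop), ContinuousLinearMap.prod_apply,
    fderiv_fun_sub (by fun_prop) (by fun_prop), fderiv_fun_mul (by fun_prop) (by fun_prop),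
    fderiv_fun_smul hr (by fun_prop)]
  ext
  · simp only [sub_apply, add_apply, smul_apply, hφB, hξB, fderiv_inv_snd hp,
      ContinuousLinearMap.smulRight_apply]
    match_scalars <;> ring
  · simp only [add_apply, smul_apply, hηB, fderiv_snd, smul_eq_mul, ContinuousLinearMap.coe_snd']
    ring

theorem coneMetric_symm (hg : ∀ X Y, g p.1 X Y = g p.1 Y X) (A B : E × ℝ) :
    coneMetric g p A B = coneMetric g p B A := by
  rw [coneMetric_apply, coneMetric_apply, hg, mul_comm A.2]

theorem coneMetric_nondegenerate (hg : ∀ X, (∀ Y, g p.1 X Y = 0) → X = 0) (hp : p.2 ≠ 0)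
    (A : E × ℝ) (hA : ∀ B, coneMetric g p A B = 0) : A = 0 := by
  refine Prod.ext (hg _ fun Y => ?_) ?_
  · simpa [coneMetric_apply, hp] using hA (Y, 0)
  · simpa [coneMetric_apply] using hA (0, 1)

theorem fderiv_coneMetric_eq (hg : DifferentiableAt ℝ g p.1) (hsymm : ∀ X Y, g p.1 X Y = g p.1 Y X)
    (hΓ : ∀ m X Y, fderiv ℝ g p.1 m X Y = g p.1 (Γ p.1 m X) Y + g p.1 X (Γ p.1 m Y)) (hp : p.2 ≠ 0)
    (A B C : E × ℝ) : fderiv ℝ (coneMetric g) p A B C =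
      coneMetric g p (coneConn g Γ p A B) C + coneMetric g p B (coneConn g Γ p A C) := by
  rw [fderiv_coneMetric hg, hΓ]
  simp only [coneMetric_apply, coneConn_apply, map_add, map_smul, add_apply, smul_apply,
    smul_eq_mul, hsymm B.1 A.1]
  field_simp
  ring

theorem curv_coneConn (hg : DifferentiableAt ℝ g p.1) (hΓ : DifferentiableAt ℝ Γ p.1)
    (hsymm : ∀ X Y, g p.1 X Y = g p.1 Y X) (hΓ_symm : ∀ X Y, Γ p.1 X Y = Γ p.1 Y X)
    (hΓ_metric : ∀ m X Y, fderiv ℝ g p.1 m X Y = g p.1 (Γ p.1 m X) Y + g p.1 X (Γ p.1 m Y))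
    (hp : p.2 ≠ 0) (A B C : E × ℝ) :
    curv (coneConn g Γ) p A B C =
      (curv Γ p.1 A.1 B.1 C.1 - g p.1 B.1 C.1 • A.1 + g p.1 A.1 C.1 • B.1, 0) := by
  ext
  · simp only [curv_apply, fderiv_coneConn hg hΓ hp, coneConn_apply, hΓ_symm B.1 A.1, map_add,
      map_smul, Prod.fst_add, Prod.fst_sub]
    match_scalars <;> field_simp <;> ring
  · simp only [curv_apply, fderiv_coneConn hg hΓ hp, coneConn_apply, hΓ_metric, map_add,
      map_smul, smul_eq_mul, Prod.snd_add, Prod.snd_sub, hsymm B.1 A.1, hsymm (Γ _ _ _) C.1,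
      hΓ_symm B.1 A.1]
    field_simp
    ring

theorem covEnd_coneJ (hg : DifferentiableAt ℝ g p.1) (hφ : DifferentiableAt ℝ φ p.1)
    (hξ : DifferentiableAt ℝ ξ p.1) (hsymm : ∀ X Y, g p.1 X Y = g p.1 Y X)
    (hΓ_metric : ∀ m X Y, fderiv ℝ g p.1 m X Y = g p.1 (Γ p.1 m X) Y + g p.1 X (Γ p.1 m Y))
    (hp : p.2 ≠ 0) (A B : E × ℝ) :
    covEnd (coneConn g Γ) (coneJ g φ ξ) p A B =
      (covEnd Γ φ p.1 A.1 B.1 + g p.1 (ξ p.1) B.1 • A.1 - g p.1 A.1 B.1 • ξ p.1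
          - (p.2⁻¹ * B.2) • (covVec Γ ξ p.1 A.1 + φ p.1 A.1),
        p.2 * (g p.1 (covVec Γ ξ p.1 A.1) B.1 - g p.1 A.1 (φ p.1 B.1))) := by
  have hη : fderiv ℝ (fun z => g z (ξ z) B.1) p.1 A.1 =
      g p.1 (covVec Γ ξ p.1 A.1) B.1 + g p.1 (ξ p.1) (Γ p.1 A.1 B.1) := by
    rw [fderiv_metric_apply hg hΓ_metric hξ (by fun_prop), covVec_const]
  rw [covEnd_apply, fderiv_coneJ hg hφ hξ hp, hη]
  simp only [coneConn_apply, coneJ_apply, covEnd_apply, covVec_apply]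
  ext
  · simp only [map_add, map_sub, map_smul, Prod.fst_add, Prod.fst_sub, smul_add, smul_sub]
    match_scalars <;> field_simp <;> ring
  · simp only [map_add, map_sub, map_smul, add_apply, Prod.snd_add, Prod.snd_sub, smul_eq_mul,
      hsymm A.1 (ξ p.1)]
    field_simp
    ring

theorem fderiv_coneForm (hg : DifferentiableAt ℝ g p.1) (hξ : DifferentiableAt ℝ ξ p.1)
    (A B : E × ℝ) : fderiv ℝ (coneForm g ξ) p A B =
      p.2 ^ 2 * fderiv ℝ (fun z => g z (ξ z) B.1) p.1 A.1 + 2 * p.2 * A.2 * g p.1 (ξ p.1) B.1 := by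
  have hη : fderiv ℝ (fun q : E × ℝ => g q.1 (ξ q.1) B.1) p A =
      fderiv ℝ (fun z => g z (ξ z) B.1) p.1 A.1 :=
    fderiv_comp_fst (T := fun z => g z (ξ z) B.1) (by fun_prop) A
  have hα : DifferentiableAt ℝ (coneForm g ξ) p := by
    unfold coneForm
    fun_prop
  rw [← fderiv_clm_apply_const hα]
  change fderiv ℝ (fun q : E × ℝ => q.2 ^ 2 * g q.1 (ξ q.1) B.1) p A = _
  rw [fderiv_fun_mul (by fun_prop) (by fun_prop), fderiv_fun_pow _ (by fun_prop)]
  simp only [add_apply, smul_apply, hη, fderiv_snd, smul_eq_mul, ContinuousLinearMap.coe_snd']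
  ring

theorem contDiffOn_coneForm (hg : ContDiffOn ℝ ∞ g U) (hξ : ContDiffOn ℝ ∞ ξ U) :
    ContDiffOn ℝ ∞ (coneForm g ξ) (U ×ˢ Set.Ioi 0) := by
  have hη := (contDiffOn_comp_fst hg).clm_apply (contDiffOn_comp_fst hξ)
  exact (contDiffOn_snd.pow 2).smul (hη.clm_comp contDiffOn_const)

end Cone

namespace IsContactMetricOn

variable {E : Type*} [NormedAddCommGroup E] [NormedSpace ℝ E] {U : Set E}
  {g : E → E →L[ℝ] E →L[ℝ] ℝ} {Γ : E → E →L[ℝ] E →L[ℝ] E} {φ : E → E →L[ℝ] E} {ξ : E → E}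
  {y : E} {p : E × ℝ}

theorem differentiableAt_g (h : IsContactMetricOn U g Γ φ ξ) (hy : y ∈ U) :
    DifferentiableAt ℝ g y :=
  (h.contDiffOn_g.contDiffAt (h.isOpen.mem_nhds hy)).differentiableAt (by simp)

theorem differentiableAt_Γ (h : IsContactMetricOn U g Γ φ ξ) (hy : y ∈ U) :
    DifferentiableAt ℝ Γ y :=
  (h.contDiffOn_Γ.contDiffAt (h.isOpen.mem_nhds hy)).differentiableAt (by simp)

theorem differentiableAt_φ (h : IsContactMetricOn U g Γ φ ξ) (hy : y ∈ U) :
    DifferentiableAt ℝ φ y :=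
  (h.contDiffOn_φ.contDiffAt (h.isOpen.mem_nhds hy)).differentiableAt (by simp)

theorem differentiableAt_ξ (h : IsContactMetricOn U g Γ φ ξ) (hy : y ∈ U) :
    DifferentiableAt ℝ ξ y :=
  (h.contDiffOn_ξ.contDiffAt (h.isOpen.mem_nhds hy)).differentiableAt (by simp)

theorem g_ξ_φ (h : IsContactMetricOn U g Γ φ ξ) (hy : y ∈ U) (X : E) : g y (ξ y) (φ y X) = 0 := by
  simpa [h.φ_ξ y hy] using h.skew y hy (ξ y) X

theorem coneJ_coneJ (h : IsContactMetricOn U g Γ φ ξ) (hy : p.1 ∈ U) (hp : p.2 ≠ 0) (A : E × ℝ) :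
    coneJ g φ ξ p (coneJ g φ ξ p A) = -A := by
  simp only [coneJ_apply, map_sub, map_smul, h.φ_φ _ hy, h.φ_ξ _ hy, h.g_ξ_φ hy, h.ξ_ξ _ hy]
  ext <;> simp [smul_smul, hp]

theorem coneJ_skew (h : IsContactMetricOn U g Γ φ ξ) (hy : p.1 ∈ U) (hp : p.2 ≠ 0)
    (A B : E × ℝ) :
    coneMetric g p (coneJ g φ ξ p A) B = -coneMetric g p A (coneJ g φ ξ p B) := by
  simp only [coneMetric_apply, coneJ_apply, map_sub, map_smul, sub_apply, smul_apply, smul_eq_mul,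
    h.skew _ hy, h.symm _ hy A.1 (ξ p.1)]
  field_simp
  ring

theorem coneMetric_coneJ (h : IsContactMetricOn U g Γ φ ξ) (hy : p.1 ∈ U) (hp : p.2 ≠ 0)
    (A B : E × ℝ) : coneMetric g p A (coneJ g φ ξ p B) =
      1 / 2 * (fderiv ℝ (coneForm g ξ) p A B - fderiv ℝ (coneForm g ξ) p B A) := by
  have hdη := h.dη _ hy A.1 B.1
  rw [fderiv_coneForm (h.differentiableAt_g hy) (h.differentiableAt_ξ hy),
    fderiv_coneForm (h.differentiableAt_g hy) (h.differentiableAt_ξ hy)]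
  simp only [coneMetric_apply, coneJ_apply, map_sub, map_smul, smul_eq_mul,
    h.symm _ hy A.1 (ξ p.1)]
  field_simp
  linear_combination -p.2 * hdη

theorem coneJ_closed (h : IsContactMetricOn U g Γ φ ξ) (hp : p ∈ U ×ˢ Set.Ioi (0 : ℝ))
    (A B C : E × ℝ) :
    fderiv ℝ (fun q => coneMetric g q B (coneJ g φ ξ q C)) p A
      + fderiv ℝ (fun q => coneMetric g q C (coneJ g φ ξ q A)) p B
      + fderiv ℝ (fun q => coneMetric g q A (coneJ g φ ξ q B)) p C = 0 := by
  have hU : U ×ˢ Set.Ioi (0 : ℝ) ∈ nhds p := (h.isOpen.prod isOpen_Ioi).mem_nhds hp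
  have hα := (contDiffOn_coneForm h.contDiffOn_g h.contDiffOn_ξ).contDiffAt hU
  have hα' := differentiableAt_fderiv hα
  have hexact (A B C : E × ℝ) : fderiv ℝ (fun q => coneMetric g q B (coneJ g φ ξ q C)) p A =
      1 / 2 * fderiv ℝ (fun q =>
        fderiv ℝ (coneForm g ξ) q B C - fderiv ℝ (coneForm g ξ) q C B) p A := by
    have heq : (fun q => coneMetric g q B (coneJ g φ ξ q C)) =ᶠ[nhds p] fun q =>
        1 / 2 * (fderiv ℝ (coneForm g ξ) q B C - fderiv ℝ (coneForm g ξ) q C B) := by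
      filter_upwards [hU] with q hq using h.coneMetric_coneJ hq.1 hq.2.ne' B C
    rw [heq.fderiv_eq, fderiv_const_mul (by fun_prop), smul_apply, smul_eq_mul]
  rw [hexact, hexact, hexact, ← mul_add, ← mul_add, fderiv_extDeriv_cyclic hα, mul_zero]

theorem isAlmostKahlerOn_cone (h : IsContactMetricOn U g Γ φ ξ) :
    IsAlmostKahlerOn (U ×ˢ Set.Ioi 0) (coneMetric g) (coneConn g Γ) (coneJ g φ ξ) where
  isOpen := h.isOpen.prod isOpen_Ioi
  contDiffOn_g := contDiffOn_coneMetric h.contDiffOn_g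
  contDiffOn_Γ := contDiffOn_coneConn h.contDiffOn_g h.contDiffOn_Γ
  contDiffOn_J := contDiffOn_coneJ h.contDiffOn_g h.contDiffOn_φ h.contDiffOn_ξ
  symm _ hp := coneMetric_symm (h.symm _ hp.1)
  nondegenerate _ hp := coneMetric_nondegenerate (h.nondegenerate _ hp.1) hp.2.ne'
  Γ_symm p hp A B := by
    simp only [coneConn_apply, h.Γ_symm _ hp.1 A.1, h.symm _ hp.1 A.1, add_comm (A.2 • B.1)]
  Γ_metric _ hp := fderiv_coneMetric_eq (h.differentiableAt_g hp.1) (h.symm _ hp.1)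
    (h.Γ_metric _ hp.1) hp.2.ne'
  J_J _ hp := h.coneJ_coneJ hp.1 hp.2.ne'
  skew _ hp := h.coneJ_skew hp.1 hp.2.ne'
  closed _ hp := h.coneJ_closed hp

theorem isAlmostKahlerTwoJet_cone (h : IsContactMetricOn U g Γ φ ξ) (hy : y ∈ U) :
    IsAlmostKahlerTwoJet (coneMetric g (y, 1)) (coneJ g φ ξ (y, 1))
      (covEnd (coneConn g Γ) (coneJ g φ ξ) (y, 1))
      (covBilin (coneConn g Γ) (covEnd (coneConn g Γ) (coneJ g φ ξ)) (y, 1))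
      (fun A B => curv (coneConn g Γ) (y, 1) A B) :=
  h.isAlmostKahlerOn_cone.isAlmostKahlerTwoJet ⟨hy, Set.mem_Ioi.2 one_pos⟩

theorem g_φ_φ (h : IsContactMetricOn U g Γ φ ξ) (hy : y ∈ U) (X Y : E) :
    g y (φ y X) (φ y Y) = g y X Y - g y (ξ y) X * g y (ξ y) Y := by
  rw [h.skew y hy, h.φ_φ y hy, map_add, map_neg, map_smul, smul_eq_mul, h.symm y hy X (ξ y)]
  ring

theorem coneMetric_curv (h : IsContactMetricOn U g Γ φ ξ) (hy : y ∈ U) (A B C D : E × ℝ) :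
    coneMetric g (y, 1) (curv (coneConn g Γ) (y, 1) A B C) D =
      g y (curv Γ y A.1 B.1 C.1) D.1 - g y B.1 C.1 * g y A.1 D.1
        + g y A.1 C.1 * g y B.1 D.1 := by
  rw [curv_coneConn (h.differentiableAt_g hy) (h.differentiableAt_Γ hy) (h.symm y hy)
    (h.Γ_symm y hy) (h.Γ_metric y hy) one_ne_zero]
  simp [coneMetric_apply]

theorem covEnd_coneJ_apply (h : IsContactMetricOn U g Γ φ ξ) (hy : y ∈ U) (A B : E × ℝ) :
    covEnd (coneConn g Γ) (coneJ g φ ξ) (y, 1) A B =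
      (covEnd Γ φ y A.1 B.1 + g y (ξ y) B.1 • A.1 - g y A.1 B.1 • ξ y
          - B.2 • (covVec Γ ξ y A.1 + φ y A.1),
        g y (covVec Γ ξ y A.1) B.1 - g y A.1 (φ y B.1)) := by
  simpa using covEnd_coneJ (p := (y, 1)) (h.differentiableAt_g hy) (h.differentiableAt_φ hy)
    (h.differentiableAt_ξ hy) (h.symm y hy) (h.Γ_metric y hy) one_ne_zero A B

theorem g_covVec (h : IsContactMetricOn U g Γ φ ξ) (hy : y ∈ U) (X Y : E) :
    g y (covVec Γ ξ y X) Y = g y X (covVec Γ ξ y Y + (2 : ℝ) • φ y Y) := by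
  have hη (X Y : E) : fderiv ℝ (fun z => g z (ξ z) Y) y X =
      g y (covVec Γ ξ y X) Y + g y (ξ y) (Γ y X Y) := by
    rw [fderiv_metric_apply (h.differentiableAt_g hy) (h.Γ_metric y hy)
      (h.differentiableAt_ξ hy) (by fun_prop), covVec_const]
  have hdη := h.dη y hy X Y
  rw [hη, hη, h.Γ_symm y hy Y X] at hdη
  rw [map_add, map_smul, smul_eq_mul, h.symm y hy X (covVec Γ ξ y Y)]
  linarith

theorem g_covEnd (h : IsContactMetricOn U g Γ φ ξ) (hy : y ∈ U) (X Y Z : E) :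
    g y (covEnd Γ φ y X Y) Z = g y X (covEnd Γ φ y Z Y - covEnd Γ φ y Y Z) := by
  have ht := (h.isAlmostKahlerTwoJet_cone hy).g_t (X, 0) (Y, 0) (Z, 0)
  simp only [h.covEnd_coneJ_apply hy, coneMetric_apply, map_add, map_sub, map_smul, add_apply,
    sub_apply, smul_apply, smul_eq_mul, zero_smul, sub_zero, one_pow, one_mul, mul_zero, zero_mul,
    add_zero, h.symm y hy X (ξ y), h.symm y hy Z Y] at ht
  rw [map_sub]
  linarith

theorem covEnd_coneJ_sub (h : IsContactMetricOn U g Γ φ ξ) (hy : y ∈ U) (X Y : E) :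
    covEnd (coneConn g Γ) (coneJ g φ ξ) (y, 1) (Y, 0) (X, 0)
      - covEnd (coneConn g Γ) (coneJ g φ ξ) (y, 1) (X, 0) (Y, 0) =
    (covEnd Γ φ y Y X - covEnd Γ φ y X Y + g y (ξ y) X • Y - g y (ξ y) Y • X, 0) := by
  rw [h.covEnd_coneJ_apply hy, h.covEnd_coneJ_apply hy]
  ext
  · simp only [Prod.fst_sub, zero_smul, h.symm y hy Y X]
    abel
  · simp only [Prod.snd_sub, h.g_covVec hy X Y, map_add, map_smul, smul_eq_mul,
      h.symm y hy X (covVec Γ ξ y Y), h.symm y hy Y (φ y X), h.skew y hy X]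
    ring

theorem covEnd_coneJ_radial_sub (h : IsContactMetricOn U g Γ φ ξ) (hy : y ∈ U) (X : E) :
    covEnd (coneConn g Γ) (coneJ g φ ξ) (y, 1) (0, 1) (X, 0)
      - covEnd (coneConn g Γ) (coneJ g φ ξ) (y, 1) (X, 0) (0, 1) =
    (covVec Γ ξ y X + φ y X, 0) := by
  rw [h.covEnd_coneJ_apply hy, h.covEnd_coneJ_apply hy]
  ext <;> simp

theorem curvature_identity (h : IsContactMetricOn U g Γ φ ξ) (hy : y ∈ U) (X Y Z W : E) :
    g y (curv Γ y X Y Z) W + g y (curv Γ y (φ y X) (φ y Y) (φ y Z)) (φ y W)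
      + g y (curv Γ y (φ y X) Y (φ y Z)) W + g y (curv Γ y X (φ y Y) Z) (φ y W)
      - g y (curv Γ y (φ y X) (φ y Y) Z) W - g y (curv Γ y X Y (φ y Z)) (φ y W)
      + g y (curv Γ y (φ y X) Y Z) (φ y W) + g y (curv Γ y X (φ y Y) (φ y Z)) W
      + 4 * g y (φ y X) W * g y (φ y Y) Z - 4 * g y (φ y Y) W * g y (φ y X) Z
      - 4 * g y X W * g y Y Z + 4 * g y Y W * g y X Z
      + 4 * g y X W * g y (ξ y) Y * g y (ξ y) Z + 4 * g y Y Z * g y (ξ y) X * g y (ξ y) W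
      - 4 * g y Y W * g y (ξ y) X * g y (ξ y) Z - 4 * g y X Z * g y (ξ y) Y * g y (ξ y) W
    = 2 * g y (covEnd Γ φ y Y X - covEnd Γ φ y X Y) (covEnd Γ φ y W Z - covEnd Γ φ y Z W)
      + 2 * g y (ξ y) Z * g y (covEnd Γ φ y W X) Y - 2 * g y (ξ y) W * g y (covEnd Γ φ y Z X) Y
      + 2 * g y (ξ y) X * g y (covEnd Γ φ y Y Z) W
      - 2 * g y (ξ y) Y * g y (covEnd Γ φ y X Z) W := by
  have hK := (h.isAlmostKahlerTwoJet_cone hy).curvature_identity (X, 0) (Y, 0) (Z, 0) (W, 0)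
  simp only [h.coneMetric_curv hy, coneJ_apply, h.covEnd_coneJ_sub hy, coneMetric_apply, zero_smul,
    smul_zero, sub_zero, one_pow, one_mul, mul_zero, add_zero, h.g_φ_φ hy] at hK
  rw [h.g_covEnd hy W X Y, h.g_covEnd hy Z X Y, h.g_covEnd hy Y Z W, h.g_covEnd hy X Z W]
  simp only [map_add, map_sub, map_smul, add_apply, sub_apply, smul_apply, smul_eq_mul, h.skew y hy,
    h.symm y hy W (covEnd Γ φ y _ _), h.symm y hy Z (covEnd Γ φ y _ _)] at hK ⊢
  linear_combination hK

theorem curvature_identity_ξ (h : IsContactMetricOn U g Γ φ ξ) (hy : y ∈ U) (Y Z W : E) :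
    g y (curv Γ y (ξ y) (φ y Y) (φ y Z)) (φ y W) + g y (curv Γ y (ξ y) Y (φ y Z)) W
      - g y (curv Γ y (ξ y) (φ y Y) Z) W + g y (curv Γ y (ξ y) Y Z) (φ y W)
    = 2 * g y (covVec Γ ξ y Y + φ y Y) (covEnd Γ φ y W Z - covEnd Γ φ y Z W)
      + 2 * g y (ξ y) Z * g y (covVec Γ ξ y W) Y - 2 * g y (ξ y) W * g y (covVec Γ ξ y Z) Y := by
  have hK := (h.isAlmostKahlerTwoJet_cone hy).curvature_identity (0, 1) (Y, 0) (Z, 0) (W, 0)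
  rw [← neg_sub (covEnd _ _ _ (0, 1) _), h.covEnd_coneJ_radial_sub hy] at hK
  simp only [h.coneMetric_curv hy, coneJ_apply, h.covEnd_coneJ_sub hy, coneMetric_apply,
    h.g_φ_φ hy, h.g_ξ_φ hy, map_zero, map_neg, zero_apply, neg_apply, zero_smul, smul_zero,
    one_smul, inv_one, one_pow, zero_sub, sub_zero, zero_add, add_zero, zero_mul, mul_zero,
    one_mul] at hK
  rw [h.g_covVec hy W, h.g_covVec hy Z]
  simp only [map_add, map_sub, map_smul, add_apply, smul_apply, smul_eq_mul, h.skew y hy,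
    h.symm y hy W, h.symm y hy Z] at hK ⊢
  linear_combination -hK

theorem curvature_identity_ξ_ξ (h : IsContactMetricOn U g Γ φ ξ) (hy : y ∈ U) (X Z : E) :
    g y (curv Γ y (φ y X) (ξ y) (φ y Z)) (ξ y) + g y (curv Γ y X (ξ y) Z) (ξ y)
      + 2 * g y (φ y X) (φ y Z)
    = 2 * g y (covVec Γ ξ y X + φ y X) (covVec Γ ξ y Z + φ y Z) := by
  have hK := (h.isAlmostKahlerTwoJet_cone hy).curvature_identity (X, 0) (0, 1) (Z, 0) (0, 1)
  rw [h.covEnd_coneJ_radial_sub hy, h.covEnd_coneJ_radial_sub hy] at hK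
  simp only [h.coneMetric_curv hy, coneJ_apply, coneMetric_apply, h.g_φ_φ hy, h.g_ξ_φ hy,
    h.ξ_ξ y hy, map_zero, map_neg, zero_apply, neg_apply, zero_smul, smul_zero, one_smul, inv_one,
    one_pow, zero_sub, sub_zero, zero_add, add_zero, zero_mul, mul_zero, one_mul] at hK
  rw [h.symm y hy X (ξ y)] at hK
  linear_combination hK + 2 * h.g_φ_φ hy X Z

end IsContactMetricOn

namespace Coord

variable {m : ℕ} {F : Type*} [NormedAddCommGroup F] [NormedSpace ℝ F]

/-- The `i`-th vector of the standard basis. -/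
noncomputable abbrev basisVec (i : Fin m) : Coord m := EuclideanSpace.single i 1

/-- The linear map with prescribed values on the standard basis. -/
noncomputable def constr (v : Fin m → F) : Coord m →L[ℝ] F :=
  ∑ i, (EuclideanSpace.proj i : Coord m →L[ℝ] ℝ).smulRight (v i)

@[simp] theorem constr_basisVec (v : Fin m → F) (i : Fin m) : constr v (basisVec i) = v i := by
  simp [constr, sum_apply]

theorem sum_basisVec (X : Coord m) : ∑ i, X i • basisVec i = X := by
  ext j
  simp [Pi.single_apply]

theorem map_eq_sum (f : Coord m →L[ℝ] F) (X : Coord m) : f X = ∑ i, X i • f (basisVec i) := by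
  conv_lhs => rw [← sum_basisVec X]
  simp only [map_sum, map_smul]

theorem sum_mul_apply_basisVec (f : Coord m →L[ℝ] ℝ) (X : Coord m) :
    ∑ i, X i * f (basisVec i) = f X :=
  (map_eq_sum f X).symm

theorem clm_ext {f f' : Coord m →L[ℝ] F} (h : ∀ i, f (basisVec i) = f' (basisVec i)) :
    f = f' := by
  ext X
  simp only [map_eq_sum f X, map_eq_sum f' X, h]

theorem clm_ext₂ {f f' : Coord m →L[ℝ] Coord m →L[ℝ] F}
    (h : ∀ i j, f (basisVec i) (basisVec j) = f' (basisVec i) (basisVec j)) (X Y : Coord m) :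
    f X Y = f' X Y := by
  rw [clm_ext fun i => clm_ext (h i)]

theorem clm_ext₃ {f f' : Coord m →L[ℝ] Coord m →L[ℝ] Coord m →L[ℝ] F}
    (h : ∀ i j k, f (basisVec i) (basisVec j) (basisVec k) =
      f' (basisVec i) (basisVec j) (basisVec k)) (X Y Z : Coord m) : f X Y Z = f' X Y Z := by
  rw [clm_ext fun i => clm_ext fun j => clm_ext (h i j)]

section CurvatureSlots

variable (b : Coord m →L[ℝ] Coord m →L[ℝ] ℝ)
  (K : Coord m →L[ℝ] Coord m →L[ℝ] Coord m →L[ℝ] Coord m) (u X Y Z W : Coord m)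

theorem sum_mul_trilinear₁ : ∑ i, u i * b (K (basisVec i) Y Z) W = b (K u Y Z) W :=
  sum_mul_apply_basisVec (b.flip W ∘L (K.flip Y).flip Z) u

theorem sum_mul_trilinear₂ : ∑ i, u i * b (K X (basisVec i) Z) W = b (K X u Z) W :=
  sum_mul_apply_basisVec (b.flip W ∘L (K X).flip Z) u

theorem sum_mul_trilinear₃ : ∑ i, u i * b (K X Y (basisVec i)) W = b (K X Y u) W :=
  sum_mul_apply_basisVec (b.flip W ∘L K X Y) u

theorem sum_mul_trilinear₄ : ∑ i, u i * b (K X Y Z) (basisVec i) = b (K X Y Z) u :=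
  sum_mul_apply_basisVec (b (K X Y Z)) u

end CurvatureSlots

/-- The field of bilinear forms with the components `g i j`. -/
noncomputable def bilinField (g : Fin m → Fin m → Coord m → ℝ) (y : Coord m) :
    Coord m →L[ℝ] Coord m →L[ℝ] ℝ :=
  constr fun i => constr fun j => g i j y

/-- The field of endomorphisms `∂ᵢ ↦ ∑ₐ φᵢᵃ ∂ₐ`; as for `AlmostContactMetricStructure.φUp`, the
lower index of the components `φ i a` comes first. -/
noncomputable def endField (φ : Fin m → Fin m → Coord m → ℝ) (y : Coord m) :
    Coord m →L[ℝ] Coord m :=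
  constr fun i => WithLp.toLp 2 fun a => φ i a y

/-- The vector field with the components `ξ a`. -/
def vecField (ξ : Fin m → Coord m → ℝ) (y : Coord m) : Coord m := WithLp.toLp 2 fun a => ξ a y

/-- The Levi-Civita connection of the metric with the components `g i j`, as the bilinear map that
is to be added to the directional derivative. -/
noncomputable def connField (g : Fin m → Fin m → Coord m → ℝ) (y : Coord m) :
    Coord m →L[ℝ] Coord m →L[ℝ] Coord m :=
  constr fun i => constr fun j => WithLp.toLp 2 fun k => christoffel g k i j y

@[simp] theorem bilinField_basisVec (g : Fin m → Fin m → Coord m → ℝ) (y : Coord m)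
    (i j : Fin m) : bilinField g y (basisVec i) (basisVec j) = g i j y := by
  simp only [bilinField, constr_basisVec]

@[simp] theorem endField_basisVec (φ : Fin m → Fin m → Coord m → ℝ) (y : Coord m)
    (i a : Fin m) : endField φ y (basisVec i) a = φ i a y := by
  simp only [endField, constr_basisVec]

theorem vecField_apply (ξ : Fin m → Coord m → ℝ) (y : Coord m) (a : Fin m) :
    vecField ξ y a = ξ a y := rfl

@[simp] theorem connField_basisVec (g : Fin m → Fin m → Coord m → ℝ) (y : Coord m)
    (i j k : Fin m) : connField g y (basisVec i) (basisVec j) k = christoffel g k i j y := by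
  simp only [connField, constr_basisVec]

section Smoothness

variable {U : Set (Coord m)} {g : Fin m → Fin m → Coord m → ℝ}

theorem contDiffOn_constr {v : Coord m → Fin m → F}
    (h : ∀ i, ContDiffOn ℝ ∞ (fun y => v y i) U) : ContDiffOn ℝ ∞ (fun y => constr (v y)) U :=
  ContDiffOn.sum fun i _ =>
    (ContinuousLinearMap.smulRightL ℝ (Coord m) F (EuclideanSpace.proj i)).contDiff.comp_contDiffOn
      (h i)

theorem contDiffOn_bilinField (h : ∀ i j, ContDiffOn ℝ ∞ (g i j) U) :
    ContDiffOn ℝ ∞ (bilinField g) U :=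
  contDiffOn_constr fun i => contDiffOn_constr fun j => h i j

theorem contDiffOn_endField {φ : Fin m → Fin m → Coord m → ℝ}
    (h : ∀ i a, ContDiffOn ℝ ∞ (φ i a) U) : ContDiffOn ℝ ∞ (endField φ) U :=
  contDiffOn_constr fun i => contDiffOn_euclidean.2 fun a => h i a

theorem contDiffOn_vecField {ξ : Fin m → Coord m → ℝ} (h : ∀ a, ContDiffOn ℝ ∞ (ξ a) U) :
    ContDiffOn ℝ ∞ (vecField ξ) U :=
  contDiffOn_euclidean.2 h

theorem contDiffOn_partialDeriv (hU : IsOpen U) {f : Coord m → ℝ} (hf : ContDiffOn ℝ ∞ f U)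
    (i : Fin m) : ContDiffOn ℝ ∞ (partialDeriv i f) U :=
  (hf.fderiv_of_isOpen hU (by simp)).clm_apply contDiffOn_const

theorem contDiffOn_det {A : Coord m → Matrix (Fin m) (Fin m) ℝ}
    (h : ∀ i j, ContDiffOn ℝ ∞ (fun y => A y i j) U) : ContDiffOn ℝ ∞ (fun y => (A y).det) U := by
  simp only [Matrix.det_apply']
  exact ContDiffOn.sum fun σ _ => contDiffOn_const.mul (contDiffOn_prod fun i _ => h _ _)

theorem contDiffOn_metricInv (h : ∀ i j, ContDiffOn ℝ ∞ (g i j) U)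
    (hdet : ∀ y ∈ U, (Matrix.of fun a b => g a b y).det ≠ 0) (i j : Fin m) :
    ContDiffOn ℝ ∞ (metricInv g i j) U := by
  have cramer : metricInv g i j = fun y => (Matrix.of fun a b => g a b y).det⁻¹ *
      (Matrix.of fun a b => g a b y).adjugate i j := by
    ext y
    simp [metricInv, Matrix.inv_def]
  rw [cramer]
  refine ((contDiffOn_det fun i j => h i j).inv hdet).mul ?_
  simp only [Matrix.adjugate_apply]
  refine contDiffOn_det fun a b => ?_
  by_cases hab : a = j
  · subst hab
    simpa using contDiffOn_const
  · simpa [hab] using h a b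

theorem contDiffOn_connField (hU : IsOpen U) (h : ∀ i j, ContDiffOn ℝ ∞ (g i j) U)
    (hdet : ∀ y ∈ U, (Matrix.of fun a b => g a b y).det ≠ 0) : ContDiffOn ℝ ∞ (connField g) U := by
  refine contDiffOn_constr fun i => contDiffOn_constr fun j => contDiffOn_euclidean.2 fun k => ?_
  have hpartial (a b c : Fin m) := contDiffOn_partialDeriv hU (h a b) c
  exact contDiffOn_const.mul <| ContDiffOn.sum fun l _ => (contDiffOn_metricInv h hdet k l).mul
    (((hpartial _ _ _).add (hpartial _ _ _)).sub (hpartial _ _ _))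

end Smoothness

section Metric

variable {g : Fin m → Fin m → Coord m → ℝ} {y : Coord m}

theorem bilinField_apply_basisVec (X : Coord m) (j : Fin m) :
    bilinField g y X (basisVec j) = ∑ i, X i * g i j y := by
  simpa using (sum_mul_apply_basisVec ((bilinField g y).flip (basisVec j)) X).symm

theorem bilinField_pullback {V : Type*} [AddCommGroup V] [Module ℝ V] [TopologicalSpace V]
    [IsTopologicalAddGroup V] [ContinuousSMul ℝ V] (b : V →L[ℝ] V →L[ℝ] ℝ) (A : Coord m →L[ℝ] V)
    (hA : ∀ i j, g i j y = b (A (basisVec i)) (A (basisVec j))) (X Y : Coord m) :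
    bilinField g y X Y = b (A X) (A Y) := by
  rw [← sum_basisVec X, ← sum_basisVec Y]
  simp only [map_sum, map_smul, sum_apply, smul_apply, bilinField_basisVec, hA]

theorem bilinField_symm (hs : ∀ i j, g i j y = g j i y) (X Y : Coord m) :
    bilinField g y X Y = bilinField g y Y X :=
  clm_ext₂ (f' := (bilinField g y).flip) (by simpa using hs) X Y

theorem det_ne_zero (hn : ∀ X, (∀ Z, bilinField g y X Z = 0) → X = 0) :
    (Matrix.of fun a b => g a b y).det ≠ 0 := by
  intro hdet
  obtain ⟨v, hv, hvg⟩ := Matrix.exists_vecMul_eq_zero_iff.2 hdet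
  have hker : bilinField g y (WithLp.toLp 2 v) = 0 := clm_ext fun j =>
    (bilinField_apply_basisVec _ j).trans (congrFun hvg j)
  exact hv (by simpa using hn (WithLp.toLp 2 v) fun Z => by rw [hker, zero_apply])

variable (hs : ∀ i j, g i j y = g j i y) (hdet : (Matrix.of fun a b => g a b y).det ≠ 0)
include hdet

theorem sum_metricInv_mul (i j : Fin m) :
    ∑ k, metricInv g i k y * g k j y = if i = j then 1 else 0 := by
  rw [← Matrix.one_apply, ← Matrix.nonsing_inv_mul _ (isUnit_iff_ne_zero.2 hdet), Matrix.mul_apply]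
  rfl

theorem sum_mul_metricInv (i j : Fin m) :
    ∑ k, g i k y * metricInv g k j y = if i = j then 1 else 0 := by
  rw [← Matrix.one_apply, ← Matrix.mul_nonsing_inv _ (isUnit_iff_ne_zero.2 hdet), Matrix.mul_apply]
  rfl

include hs

theorem sum_metricInv_mul_bilinField (X : Coord m) (a : Fin m) :
    ∑ b, metricInv g a b y * bilinField g y X (basisVec b) = X a := by
  simp only [bilinField_apply_basisVec, Finset.mul_sum]
  rw [Finset.sum_comm]
  calc ∑ i, ∑ b, metricInv g a b y * (X i * g i b y)
      = ∑ i, X i * ∑ b, metricInv g a b y * g b i y := by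
        simp only [Finset.mul_sum, hs, mul_left_comm]
    _ = X a := by simp [sum_metricInv_mul hdet]

theorem bilinField_connField_basisVec (i j l : Fin m) :
    bilinField g y (connField g y (basisVec i) (basisVec j)) (basisVec l) =
      (1 / 2 : ℝ) * (partialDeriv i (g j l) y + partialDeriv j (g i l) y
        - partialDeriv l (g i j) y) := by
  rw [bilinField_apply_basisVec]
  simp only [connField_basisVec, christoffel]
  calc _ = (1 / 2 : ℝ) * ∑ r, (∑ k, g l k y * metricInv g k r y) *
        (partialDeriv i (g j r) y + partialDeriv j (g i r) y - partialDeriv r (g i j) y) := by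
        simp only [Finset.mul_sum, Finset.sum_mul]
        rw [Finset.sum_comm]
        refine Finset.sum_congr rfl fun r _ => Finset.sum_congr rfl fun k _ => ?_
        rw [hs l k]
        ring
    _ = _ := by simp [sum_mul_metricInv hdet]

end Metric

section LeviCivita

variable {U : Set (Coord m)} {g : Fin m → Fin m → Coord m → ℝ} {y : Coord m}

theorem partialDeriv_symm (hU : IsOpen U) (hs : ∀ z ∈ U, ∀ i j, g i j z = g j i z) (hy : y ∈ U)
    (l i j : Fin m) : partialDeriv l (g i j) y = partialDeriv l (g j i) y := by
  have hg : g i j =ᶠ[nhds y] g j i := by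
    filter_upwards [hU.mem_nhds hy] with z hz using hs z hz i j
  rw [partialDeriv, partialDeriv, hg.fderiv_eq]

theorem connField_symm (hU : IsOpen U) (hs : ∀ z ∈ U, ∀ i j, g i j z = g j i z) (hy : y ∈ U)
    (X Y : Coord m) : connField g y X Y = connField g y Y X := by
  refine clm_ext₂ (f' := (connField g y).flip) (fun i j => ?_) X Y
  ext k
  simp only [ContinuousLinearMap.flip_apply, connField_basisVec, christoffel,
    partialDeriv_symm hU hs hy _ j i, add_comm (partialDeriv i _ y)]

theorem fderiv_bilinField_basisVec (hg : DifferentiableAt ℝ (bilinField g) y) (a i j : Fin m) :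
    fderiv ℝ (bilinField g) y (basisVec a) (basisVec i) (basisVec j) =
      partialDeriv a (g i j) y := by
  rw [← fderiv_clm_apply_apply_const hg]
  simp only [bilinField_basisVec, partialDeriv]

theorem koszul_formula (hg : DifferentiableAt ℝ (bilinField g) y) (hs : ∀ i j, g i j y = g j i y)
    (hdet : (Matrix.of fun a b => g a b y).det ≠ 0) (X Y Z : Coord m) :
    bilinField g y (connField g y X Y) Z =
      (1 / 2 : ℝ) * (fderiv ℝ (bilinField g) y X Y Z + fderiv ℝ (bilinField g) y Y X Z
        - fderiv ℝ (bilinField g) y Z X Y) := by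
  let D := fderiv ℝ (bilinField g) y
  let flipL := (ContinuousLinearMap.flipₗᵢ ℝ (Coord m) (Coord m) ℝ).toContinuousLinearEquiv
  refine clm_ext₃
    (f := ContinuousLinearMap.compL ℝ (Coord m) (Coord m) (Coord m →L[ℝ] ℝ) (bilinField g y)
      ∘L connField g y)
    (f' := (1 / 2 : ℝ) • (D + D.flip - (flipL : _ →L[ℝ] _) ∘L D.flip)) (fun i j k => ?_) X Y Z
  have hD (a i j : Fin m) : D (basisVec a) (basisVec i) (basisVec j) = partialDeriv a (g i j) y :=
    fderiv_bilinField_basisVec hg a i j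
  change bilinField g y (connField g y (basisVec i) (basisVec j)) (basisVec k) = (1 / 2 : ℝ) *
    (D (basisVec i) (basisVec j) (basisVec k) + D (basisVec j) (basisVec i) (basisVec k)
      - D (basisVec k) (basisVec i) (basisVec j))
  rw [bilinField_connField_basisVec hs hdet, hD, hD, hD]

theorem fderiv_bilinField (hU : IsOpen U) (hg : DifferentiableAt ℝ (bilinField g) y)
    (hs : ∀ z ∈ U, ∀ i j, g i j z = g j i z)
    (hdet : (Matrix.of fun a b => g a b y).det ≠ 0) (hy : y ∈ U) (v X Y : Coord m) :
    fderiv ℝ (bilinField g) y v X Y =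
      bilinField g y (connField g y v X) Y + bilinField g y X (connField g y v Y) := by
  have hD_symm (v X Y : Coord m) :
      fderiv ℝ (bilinField g) y v X Y = fderiv ℝ (bilinField g) y v Y X := by
    have hg_symm : (fun z => bilinField g z X Y) =ᶠ[nhds y] fun z => bilinField g z Y X := by
      filter_upwards [hU.mem_nhds hy] with z hz using bilinField_symm (hs z hz) X Y
    rw [← fderiv_clm_apply_apply_const hg, ← fderiv_clm_apply_apply_const hg, hg_symm.fderiv_eq]
  rw [bilinField_symm (hs y hy) X, koszul_formula hg (hs y hy) hdet,
    koszul_formula hg (hs y hy) hdet, hD_symm v Y X]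
  ring

theorem fderiv_connField_basisVec (hΓ : DifferentiableAt ℝ (connField g) y) (i j k l : Fin m) :
    fderiv ℝ (connField g) y (basisVec i) (basisVec j) (basisVec k) l =
      partialDeriv i (christoffel g l j k) y := by
  have hcomp : christoffel g l j k =
      EuclideanSpace.proj l ∘ fun z => connField g z (basisVec j) (basisVec k) :=
    funext fun z => (connField_basisVec g z j k l).symm
  rw [partialDeriv, hcomp, fderiv_comp y (by fun_prop) (by fun_prop),
    ContinuousLinearMap.fderiv, ContinuousLinearMap.comp_apply, fderiv_clm_apply_apply_const hΓ]
  rfl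

theorem curv_connField_basisVec (hΓ : DifferentiableAt ℝ (connField g) y) (i j k l : Fin m) :
    curv (connField g) y (basisVec i) (basisVec j) (basisVec k) l = curvatureUp g i j k l y := by
  have hΓΓ (i j k : Fin m) :
      connField g y (basisVec i) (connField g y (basisVec j) (basisVec k)) l =
        ∑ a, christoffel g l i a y * christoffel g a j k y := by
    rw [map_eq_sum (connField g y (basisVec i))]
    simp [mul_comm]
  simp only [curv_apply, PiLp.add_apply, PiLp.sub_apply, fderiv_connField_basisVec hΓ, hΓΓ,
    curvatureUp, Finset.sum_sub_distrib]
  ring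

theorem curvature_eq (hΓ : DifferentiableAt ℝ (connField g) y) (i j k l : Fin m) :
    curvature g i j k l y =
      bilinField g y (curv (connField g) y (basisVec i) (basisVec j) (basisVec k))
        (basisVec l) := by
  simp only [bilinField_apply_basisVec, curvature, curv_connField_basisVec hΓ, mul_comm]

theorem covDerivTwo_eq {φ : Coord m → Coord m →L[ℝ] Coord m} {t : Fin m → Fin m → Coord m → ℝ}
    (hg : DifferentiableAt ℝ (bilinField g) y) (hφ : DifferentiableAt ℝ φ y)
    (hΓ : ∀ m X Y, fderiv ℝ (bilinField g) y m X Y =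
      bilinField g y (connField g y m X) Y + bilinField g y X (connField g y m Y))
    (ht : ∀ᶠ z in nhds y, ∀ i j, t i j z = bilinField g z (φ z (basisVec i)) (basisVec j))
    (a i j : Fin m) :
    covDerivTwo g t a i j y =
      bilinField g y (covEnd (connField g) φ y (basisVec a) (basisVec i)) (basisVec j) := by
  have ht_eq : t i j =ᶠ[nhds y] fun z => bilinField g z (φ z (basisVec i)) (basisVec j) :=
    ht.mono fun z hz => hz i j
  have hΓ_left : ∑ b, christoffel g b a i y * t b j y =
      bilinField g y (φ y (connField g y (basisVec a) (basisVec i))) (basisVec j) := by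
    simpa [ht.self_of_nhds] using sum_mul_apply_basisVec
      ((bilinField g y).flip (basisVec j) ∘L φ y) (connField g y (basisVec a) (basisVec i))
  have hΓ_right : ∑ b, christoffel g b a j y * t i b y =
      bilinField g y (φ y (basisVec i)) (connField g y (basisVec a) (basisVec j)) := by
    simpa [ht.self_of_nhds] using sum_mul_apply_basisVec
      (bilinField g y (φ y (basisVec i))) (connField g y (basisVec a) (basisVec j))
  rw [covDerivTwo, hΓ_left, hΓ_right, partialDeriv, ht_eq.fderiv_eq,
    fderiv_metric_apply hg hΓ (by fun_prop) (by fun_prop), covVec_endo hφ (by fun_prop),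
    covVec_const, covVec_const, map_add, add_apply]
  ring

theorem covDerivOne_eq {ξ : Coord m → Coord m} {θ : Fin m → Coord m → ℝ}
    (hg : DifferentiableAt ℝ (bilinField g) y) (hξ : DifferentiableAt ℝ ξ y)
    (hΓ : ∀ m X Y, fderiv ℝ (bilinField g) y m X Y =
      bilinField g y (connField g y m X) Y + bilinField g y X (connField g y m Y))
    (hθ : ∀ᶠ z in nhds y, ∀ i, θ i z = bilinField g z (ξ z) (basisVec i)) (a j : Fin m) :
    covDerivOne g θ a j y =
      bilinField g y (covVec (connField g) ξ y (basisVec a)) (basisVec j) := by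
  have hθ_eq : θ j =ᶠ[nhds y] fun z => bilinField g z (ξ z) (basisVec j) :=
    hθ.mono fun z hz => hz j
  have hΓ_sum : ∑ b, christoffel g b a j y * θ b y =
      bilinField g y (ξ y) (connField g y (basisVec a) (basisVec j)) := by
    simpa [hθ.self_of_nhds] using sum_mul_apply_basisVec
      (bilinField g y (ξ y)) (connField g y (basisVec a) (basisVec j))
  rw [covDerivOne, hΓ_sum, partialDeriv, hθ_eq.fderiv_eq,
    fderiv_metric_apply hg hΓ hξ (by fun_prop), covVec_const]
  ring

end LeviCivita

end Coord

theorem contDiffOn_of_contMDiffOn_trivial {E F E' H' M : Type*} [NormedAddCommGroup E]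
    [NormedSpace ℝ E] [NormedAddCommGroup F] [NormedSpace ℝ F] [NormedAddCommGroup E']
    [NormedSpace ℝ E'] [TopologicalSpace H'] {I : ModelWithCorners ℝ E' H'} [TopologicalSpace M]
    [ChartedSpace H' M] {U : Set E} {b : E → M} {f : E → F}
    (h : ContMDiffOn 𝓘(ℝ, E) (I.prod 𝓘(ℝ, F)) ∞
      (fun y => TotalSpace.mk' F (E := Trivial M F) (b y) (f y)) U) : ContDiffOn ℝ ∞ f U :=
  contMDiffOn_iff_contDiffOn.1 fun y hy => (contMDiffWithinAt_totalSpace.1 (h y hy)).2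

open Coord

namespace AlmostContactMetricStructure

variable {n : ℕ} {M : Type*} [TopologicalSpace M] [ChartedSpace (Coord (2 * n + 1)) M]
  {e : OpenPartialHomeomorph M (Coord (2 * n + 1))} {y : Coord (2 * n + 1)}

/-- The differential of the inverse of the chart `e` at the point with coordinates `y`. -/
noncomputable def symmDeriv (e : OpenPartialHomeomorph M (Coord (2 * n + 1)))
    (y : Coord (2 * n + 1)) :
    Coord (2 * n + 1) →L[ℝ] TangentSpace (𝓡 (2 * n + 1)) (e.symm y) :=
  mfderiv 𝓘(ℝ, Coord (2 * n + 1)) (𝓡 (2 * n + 1)) e.symm y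

/-- The differential of the chart `e` at the point with coordinates `y`. -/
noncomputable def chartDeriv (e : OpenPartialHomeomorph M (Coord (2 * n + 1)))
    (y : Coord (2 * n + 1)) :
    TangentSpace (𝓡 (2 * n + 1)) (e.symm y) →L[ℝ] Coord (2 * n + 1) :=
  mfderiv (𝓡 (2 * n + 1)) 𝓘(ℝ, Coord (2 * n + 1)) e (e.symm y)

section Chart

variable (he : e ∈ IsManifold.maximalAtlas (𝓡 (2 * n + 1)) ∞ M)
include he

theorem mdifferentiable_of_mem_maximalAtlas :
    e.MDifferentiable (𝓡 (2 * n + 1)) 𝓘(ℝ, Coord (2 * n + 1)) :=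
  ⟨(contMDiffOn_of_mem_maximalAtlas he).mdifferentiableOn (by simp),
    (contMDiffOn_symm_of_mem_maximalAtlas he).mdifferentiableOn (by simp)⟩

theorem chartDeriv_symmDeriv (hy : y ∈ e.target) (v : Coord (2 * n + 1)) :
    chartDeriv e y (symmDeriv e y v) = v :=
  congrArg (fun f => f v) ((mdifferentiable_of_mem_maximalAtlas he).comp_symm_deriv hy)

theorem symmDeriv_chartDeriv (hy : y ∈ e.target)
    (v : TangentSpace (𝓡 (2 * n + 1)) (e.symm y)) : symmDeriv e y (chartDeriv e y v) = v := by
  have h := (mdifferentiable_of_mem_maximalAtlas he).symm_comp_deriv (e.map_target hy)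
  rw [e.right_inv hy] at h
  exact congrArg (fun f => f v) h

theorem symmDeriv_injective (hy : y ∈ e.target) : Function.Injective (symmDeriv e y) :=
  Function.LeftInverse.injective (chartDeriv_symmDeriv he hy)

variable [IsManifold (𝓡 (2 * n + 1)) ∞ M]

theorem contMDiffOn_coordVec (i : Fin (2 * n + 1)) :
    ContMDiffOn 𝓘(ℝ, Coord (2 * n + 1)) ((𝓡 (2 * n + 1)).prod 𝓘(ℝ, Coord (2 * n + 1))) ∞
      (fun y => TotalSpace.mk' (Coord (2 * n + 1))
        (E := fun p : M => TangentSpace (𝓡 (2 * n + 1)) p) (e.symm y) (coordVec e i y))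
      e.target := by
  have htangentMap := (contMDiffOn_symm_of_mem_maximalAtlas he).contMDiffOn_tangentMapWithin
    (m := ∞) (by simp) e.open_target.uniqueMDiffOn
  have hconst : ContMDiffOn 𝓘(ℝ, Coord (2 * n + 1)) (𝓘(ℝ, Coord (2 * n + 1)).tangent) ∞
      (fun y => (⟨y, basisVec i⟩ : TangentBundle 𝓘(ℝ, Coord (2 * n + 1)) (Coord (2 * n + 1))))
      e.target :=
    fun _ _ => contMDiffWithinAt_vectorSpace_iff_contDiffWithinAt.2 contDiffWithinAt_const
  refine (htangentMap.comp hconst fun y hy => hy).congr fun y hy => ?_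
  simp only [Function.comp, tangentMapWithin, coordVec, mfderivWithin_of_isOpen e.open_target hy]

end Chart

variable [IsManifold (𝓡 (2 * n + 1)) ∞ M] (S : AlmostContactMetricStructure n M)

theorem bilinField_gLow (X Y : Coord (2 * n + 1)) :
    bilinField (S.gLow e) y X Y = S.g.inner (e.symm y) (symmDeriv e y X) (symmDeriv e y Y) :=
  bilinField_pullback (S.g.inner (e.symm y)) (symmDeriv e y) (fun _ _ => rfl) X Y

theorem gLow_symm (i j : Fin (2 * n + 1)) : S.gLow e i j y = S.gLow e j i y :=
  S.g.symm _ _ _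

variable (he : e ∈ IsManifold.maximalAtlas (𝓡 (2 * n + 1)) ∞ M)
include he

section Components

variable (hy : y ∈ e.target)
include hy

theorem symmDeriv_endField (X : Coord (2 * n + 1)) :
    symmDeriv e y (endField (S.φUp e) y X) = S.φ (e.symm y) (symmDeriv e y X) := by
  have hendField : endField (S.φUp e) y =
      chartDeriv e y ∘L S.φ (e.symm y) ∘L symmDeriv e y := clm_ext fun i => by
    ext a
    rw [endField_basisVec]
    rfl
  rw [hendField]
  exact symmDeriv_chartDeriv he hy _

theorem symmDeriv_vecField : symmDeriv e y (vecField (S.ξUp e) y) = S.ξ (e.symm y) :=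
  symmDeriv_chartDeriv he hy (S.ξ (e.symm y))

theorem η_symmDeriv (X : Coord (2 * n + 1)) :
    S.η (e.symm y) (symmDeriv e y X) = bilinField (S.gLow e) y (vecField (S.ξUp e) y) X := by
  rw [bilinField_gLow, S.symmDeriv_vecField he hy, S.g_ξ]

theorem ηLow_eq (i : Fin (2 * n + 1)) :
    S.ηLow e i y = bilinField (S.gLow e) y (vecField (S.ξUp e) y) (basisVec i) :=
  S.η_symmDeriv he hy (basisVec i)

theorem φLow_eq (i j : Fin (2 * n + 1)) : S.φLow e i j y =
    bilinField (S.gLow e) y (endField (S.φUp e) y (basisVec i)) (basisVec j) := by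
  rw [bilinField_gLow, S.symmDeriv_endField he hy]
  rfl

theorem gLow_nondegenerate (X : Coord (2 * n + 1))
    (hX : ∀ Z, bilinField (S.gLow e) y X Z = 0) : X = 0 := by
  by_contra hne
  have hpos := S.g.pos (e.symm y) (symmDeriv e y X)
    ((map_ne_zero_iff _ (symmDeriv_injective he hy)).2 hne)
  rw [← S.bilinField_gLow, hX] at hpos
  exact lt_irrefl _ hpos

theorem det_gLow_ne_zero : (Matrix.of fun a b => S.gLow e a b y).det ≠ 0 :=
  det_ne_zero (S.gLow_nondegenerate he hy)

theorem g_φ_left (X Y : Coord (2 * n + 1)) :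
    bilinField (S.gLow e) y (endField (S.φUp e) y X) Y =
      -bilinField (S.gLow e) y X (endField (S.φUp e) y Y) := by
  have h := S.g_φ_φ (e.symm y) (symmDeriv e y X) (S.φ (e.symm y) (symmDeriv e y Y))
  rw [S.η_φ, S.φ_φ, map_add, map_neg, map_smul, S.g.symm _ (S.φ _ _) (S.ξ _), ← S.g_ξ, S.η_φ,
    smul_zero, add_zero, mul_zero, sub_zero] at h
  rw [bilinField_gLow, bilinField_gLow, S.symmDeriv_endField he hy, S.symmDeriv_endField he hy,
    ← h, neg_neg]

end Components

section Smoothness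

theorem contDiffOn_gLow (i j : Fin (2 * n + 1)) : ContDiffOn ℝ ∞ (S.gLow e i j) e.target :=
  contDiffOn_of_contMDiffOn_trivial <| ContMDiffOn.clm_bundle_apply₂
    (S.g.contMDiff.comp_contMDiffOn (contMDiffOn_symm_of_mem_maximalAtlas he))
    (contMDiffOn_coordVec he i) (contMDiffOn_coordVec he j)

theorem contDiffOn_ηLow (i : Fin (2 * n + 1)) : ContDiffOn ℝ ∞ (S.ηLow e i) e.target :=
  contDiffOn_of_contMDiffOn_trivial <| ContMDiffOn.clm_bundle_apply
    (S.η_smooth.comp_contMDiffOn (contMDiffOn_symm_of_mem_maximalAtlas he))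
    (contMDiffOn_coordVec he i)

theorem contDiffOn_φLow (i j : Fin (2 * n + 1)) : ContDiffOn ℝ ∞ (S.φLow e i j) e.target :=
  contDiffOn_of_contMDiffOn_trivial <| ContMDiffOn.clm_bundle_apply₂
    (S.g.contMDiff.comp_contMDiffOn (contMDiffOn_symm_of_mem_maximalAtlas he))
    (ContMDiffOn.clm_bundle_apply
      (S.φ_smooth.comp_contMDiffOn (contMDiffOn_symm_of_mem_maximalAtlas he))
      (contMDiffOn_coordVec he i)) (contMDiffOn_coordVec he j)

theorem contDiffOn_raise {t : Fin (2 * n + 1) → Coord (2 * n + 1) → ℝ}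
    (ht : ∀ b, ContDiffOn ℝ ∞ (t b) e.target) {u : Coord (2 * n + 1) → Coord (2 * n + 1)}
    (htu : ∀ y ∈ e.target, ∀ b, t b y = bilinField (S.gLow e) y (u y) (basisVec b))
    (a : Fin (2 * n + 1)) : ContDiffOn ℝ ∞ (fun y => u y a) e.target := by
  have hinv := contDiffOn_metricInv (S.contDiffOn_gLow he) fun y hy => S.det_gLow_ne_zero he hy
  refine (ContDiffOn.sum (s := Finset.univ) fun b _ => (hinv a b).mul (ht b)).congr
    fun y hy => ?_
  simp only [htu y hy]
  exact (sum_metricInv_mul_bilinField S.gLow_symm (S.det_gLow_ne_zero he hy) _ a).symm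

theorem contDiffOn_φUp (i a : Fin (2 * n + 1)) : ContDiffOn ℝ ∞ (S.φUp e i a) e.target :=
  (S.contDiffOn_raise he (S.contDiffOn_φLow he i) (fun _ hy => S.φLow_eq he hy i) a).congr
    fun y _ => (endField_basisVec _ y i a).symm

theorem contDiffOn_ξUp (a : Fin (2 * n + 1)) : ContDiffOn ℝ ∞ (S.ξUp e a) e.target :=
  S.contDiffOn_raise he (S.contDiffOn_ηLow he) (fun _ hy => S.ηLow_eq he hy) a

end Smoothness

variable {S}

theorem IsContactMetric.dη_chart (hS : S.IsContactMetric) (hy : y ∈ e.target)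
    (X Y : Coord (2 * n + 1)) :
    fderiv ℝ (fun z => bilinField (S.gLow e) z (vecField (S.ξUp e) z) Y) y X -
      fderiv ℝ (fun z => bilinField (S.gLow e) z (vecField (S.ξUp e) z) X) y Y =
    2 * bilinField (S.gLow e) y X (endField (S.φUp e) y Y) := by
  have hU := e.open_target.mem_nhds hy
  let η (z : Coord (2 * n + 1)) := bilinField (S.gLow e) z (vecField (S.ξUp e) z)
  have hdiff : DifferentiableAt ℝ η y :=
    (((contDiffOn_bilinField (S.contDiffOn_gLow he)).contDiffAt hU).differentiableAt
      (by simp)).clm_apply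
    (((contDiffOn_vecField (S.contDiffOn_ξUp he)).contDiffAt hU).differentiableAt (by simp))
  have hη (i j : Fin (2 * n + 1)) :
      fderiv ℝ η y (basisVec i) (basisVec j) = partialDeriv i (S.ηLow e j) y := by
    have hηLow : S.ηLow e j =ᶠ[nhds y] fun z => η z (basisVec j) := by
      filter_upwards [hU] with z hz using S.ηLow_eq he hz j
    rw [partialDeriv, hηLow.fderiv_eq, fderiv_clm_apply_const hdiff]
  rw [fderiv_clm_apply_const hdiff, fderiv_clm_apply_const hdiff]
  refine clm_ext₂ (f := fderiv ℝ η y - (fderiv ℝ η y).flip)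
    (f' := (2 : ℝ) • (bilinField (S.gLow e) y).bilinearComp (.id ℝ _) (endField (S.φUp e) y))
    (fun i j => ?_) X Y
  change fderiv ℝ η y (basisVec i) (basisVec j) - fderiv ℝ η y (basisVec j) (basisVec i) =
    2 * bilinField (S.gLow e) y (basisVec i) (endField (S.φUp e) y (basisVec j))
  have hdη : partialDeriv i (S.ηLow e j) y - partialDeriv j (S.ηLow e i) y =
      2 * extDerivOne (S.ηLow e) i j y := by
    rw [extDerivOne]
    ring
  rw [hη, hη, hdη, hS.dη_eq e he y hy, bilinField_gLow, S.symmDeriv_endField he hy]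
  rfl

theorem IsContactMetric.isContactMetricOn (hS : S.IsContactMetric) :
    IsContactMetricOn e.target (bilinField (S.gLow e)) (connField (S.gLow e))
      (endField (S.φUp e)) (vecField (S.ξUp e)) where
  isOpen := e.open_target
  contDiffOn_g := contDiffOn_bilinField (S.contDiffOn_gLow he)
  contDiffOn_Γ := contDiffOn_connField e.open_target (S.contDiffOn_gLow he)
    fun y hy => S.det_gLow_ne_zero he hy
  contDiffOn_φ := contDiffOn_endField (S.contDiffOn_φUp he)
  contDiffOn_ξ := contDiffOn_vecField (S.contDiffOn_ξUp he)
  symm _ _ := bilinField_symm S.gLow_symm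
  nondegenerate _ hy := S.gLow_nondegenerate he hy
  Γ_symm _ hy := connField_symm e.open_target (fun _ _ => S.gLow_symm) hy
  Γ_metric _ hy := fderiv_bilinField e.open_target
    (((contDiffOn_bilinField (S.contDiffOn_gLow he)).contDiffAt
      (e.open_target.mem_nhds hy)).differentiableAt (by simp))
    (fun _ _ => S.gLow_symm) (S.det_gLow_ne_zero he hy) hy
  φ_φ y hy X := symmDeriv_injective he hy <| by
    rw [S.symmDeriv_endField he hy, S.symmDeriv_endField he hy, S.φ_φ, map_add, map_neg, map_smul,
      S.symmDeriv_vecField he hy, S.η_symmDeriv he hy]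
  φ_ξ y hy := symmDeriv_injective he hy <| by
    rw [S.symmDeriv_endField he hy, S.symmDeriv_vecField he hy, S.φ_ξ, map_zero]
  ξ_ξ y hy := by rw [← S.η_symmDeriv he hy, S.symmDeriv_vecField he hy, S.η_ξ]
  skew _ hy := S.g_φ_left he hy
  dη _ hy := hS.dη_chart he hy

end AlmostContactMetricStructure

namespace IsContactMetricOn

variable {m : ℕ} {U : Set (Coord m)} {g φ : Fin m → Fin m → Coord m → ℝ} {ξ : Fin m → Coord m → ℝ}
  (h : IsContactMetricOn U (bilinField g) (connField g) (endField φ) (vecField ξ))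
  {y : Coord m} (hy : y ∈ U)
include h hy

theorem curvature_apply (i j k l : Fin m) :
    curvature g i j k l y = bilinField g y
      (curv (connField g) y (basisVec i) (basisVec j) (basisVec k)) (basisVec l) :=
  curvature_eq (h.differentiableAt_Γ hy) i j k l

theorem sum_metricInv_mul_apply (X : Coord m) (a : Fin m) :
    ∑ b, metricInv g a b y * bilinField g y X (basisVec b) = X a :=
  sum_metricInv_mul_bilinField (fun i j => by simpa using h.symm y hy (basisVec i) (basisVec j))
    (det_ne_zero (h.nondegenerate y hy)) X a

variable {φL : Fin m → Fin m → Coord m → ℝ} {ηL : Fin m → Coord m → ℝ}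
  (hφL : ∀ z ∈ U, ∀ i j, φL i j z = bilinField g z (endField φ z (basisVec i)) (basisVec j))
  (hηL : ∀ z ∈ U, ∀ i, ηL i z = bilinField g z (vecField ξ z) (basisVec i))

section

include hφL

theorem covDerivTwo_apply (a i j : Fin m) :
    covDerivTwo g φL a i j y = bilinField g y
      (covEnd (connField g) (endField φ) y (basisVec a) (basisVec i)) (basisVec j) :=
  covDerivTwo_eq (h.differentiableAt_g hy) (h.differentiableAt_φ hy) (h.Γ_metric y hy)
    (Filter.eventually_of_mem (h.isOpen.mem_nhds hy) hφL) a i j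

theorem sum_metricInv_mul_covDerivTwo (a i j : Fin m) :
    ∑ b, metricInv g a b y * covDerivTwo g φL b i j y =
      (covEnd (connField g) (endField φ) y (basisVec j) (basisVec i)
        - covEnd (connField g) (endField φ) y (basisVec i) (basisVec j)) a := by
  simp only [h.covDerivTwo_apply hy hφL, h.g_covEnd hy, h.symm y hy (basisVec _)]
  exact h.sum_metricInv_mul_apply hy _ a

theorem sum_mul_covDerivTwo (X : Coord m) (k l : Fin m) :
    ∑ a, X a * covDerivTwo g φL a k l y = bilinField g y X
      (covEnd (connField g) (endField φ) y (basisVec l) (basisVec k)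
        - covEnd (connField g) (endField φ) y (basisVec k) (basisVec l)) := by
  simp only [h.covDerivTwo_apply hy hφL, h.g_covEnd hy]
  exact sum_mul_apply_basisVec ((bilinField g y).flip _) X

theorem sum_φ_mul (X : Coord m) (j : Fin m) :
    ∑ a, φL a j y * X a = -bilinField g y X (endField φ y (basisVec j)) := by
  simp only [hφL y hy, mul_comm _ (X _)]
  rw [← h.skew y hy]
  exact sum_mul_apply_basisVec ((bilinField g y).flip (basisVec j) ∘L endField φ y) X

end

include hηL

theorem covDerivOne_apply (a j : Fin m) :
    covDerivOne g ηL a j y =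
      bilinField g y (covVec (connField g) (vecField ξ) y (basisVec a)) (basisVec j) :=
  covDerivOne_eq (h.differentiableAt_g hy) (h.differentiableAt_ξ hy) (h.Γ_metric y hy)
    (Filter.eventually_of_mem (h.isOpen.mem_nhds hy) hηL) a j

theorem sum_metricInv_mul_covDerivOne (a j : Fin m) :
    ∑ b, metricInv g a b y * covDerivOne g ηL b j y =
      (covVec (connField g) (vecField ξ) y (basisVec j)
        + (2 : ℝ) • endField φ y (basisVec j)) a := by
  simp only [h.covDerivOne_apply hy hηL, h.g_covVec hy, h.symm y hy (basisVec _)]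
  exact h.sum_metricInv_mul_apply hy _ a

theorem sum_covDerivOne_mul (X : Coord m) (i : Fin m) :
    ∑ a, covDerivOne g ηL a i y * X a = bilinField g y
      (covVec (connField g) (vecField ξ) y (basisVec i)
        + (2 : ℝ) • endField φ y (basisVec i)) X := by
  simp only [h.covDerivOne_apply hy hηL, h.g_covVec hy, mul_comm _ (X _)]
  rw [h.symm y hy]
  exact sum_mul_apply_basisVec ((bilinField g y).flip _) X

end IsContactMetricOn

theorem corollary1_general {m : ℕ} {U : Set (Coord m)} {g φ φL : Fin m → Fin m → Coord m → ℝ}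
    {ξ ηL : Fin m → Coord m → ℝ}
    (h : IsContactMetricOn U (bilinField g) (connField g) (endField φ) (vecField ξ))
    (hφL : ∀ z ∈ U, ∀ i j, φL i j z = bilinField g z (endField φ z (basisVec i)) (basisVec j))
    (hηL : ∀ z ∈ U, ∀ i, ηL i z = bilinField g z (vecField ξ z) (basisVec i))
    {y : Coord m} (hy : y ∈ U) :
    (∀ i j k l,
      curvature g i j k l y
        + (∑ a, ∑ b, ∑ c, ∑ d, φ i a y * φ j b y * φ k c y * φ l d y * curvature g a b c d y)
        + (∑ a, ∑ c, φ i a y * φ k c y * curvature g a j c l y)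
        + (∑ b, ∑ d, φ j b y * φ l d y * curvature g i b k d y)
        - (∑ a, ∑ b, φ i a y * φ j b y * curvature g a b k l y)
        - (∑ c, ∑ d, φ k c y * φ l d y * curvature g i j c d y)
        + (∑ a, ∑ d, φ i a y * φ l d y * curvature g a j k d y)
        + (∑ b, ∑ c, φ j b y * φ k c y * curvature g i b c l y)
        + 4 * φL i l y * φL j k y - 4 * φL j l y * φL i k y
        - 4 * g i l y * g j k y + 4 * g j l y * g i k y
        + 4 * g i l y * ηL j y * ηL k y + 4 * g j k y * ηL i y * ηL l y
        - 4 * g j l y * ηL i y * ηL k y - 4 * g i k y * ηL j y * ηL l y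
      = 2 * (∑ a, (∑ b, metricInv g a b y * covDerivTwo g φL b i j y)
          * covDerivTwo g φL a k l y)
        + 2 * ηL k y * covDerivTwo g φL l i j y - 2 * ηL l y * covDerivTwo g φL k i j y
        + 2 * ηL i y * covDerivTwo g φL j k l y - 2 * ηL j y * covDerivTwo g φL i k l y) ∧
    (∀ j k l,
      (∑ a, ∑ b, ∑ c, ∑ d, ξ a y * φ j b y * φ k c y * φ l d y * curvature g a b c d y)
        + (∑ a, ∑ c, ξ a y * φ k c y * curvature g a j c l y)
        - (∑ a, ∑ b, ξ a y * φ j b y * curvature g a b k l y)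
        + (∑ a, ∑ d, ξ a y * φ l d y * curvature g a j k d y)
      = 2 * (∑ a, (∑ b, metricInv g a b y * covDerivOne g ηL b j y) * covDerivTwo g φL a k l y)
        + 2 * ηL k y * covDerivOne g ηL l j y - 2 * ηL l y * covDerivOne g ηL k j y
        + 2 * (∑ a, φL a j y * ∑ b, metricInv g a b y * covDerivTwo g φL b k l y)) ∧
    (∀ i k,
      (∑ a, ∑ b, ∑ c, ∑ d, φ i a y * ξ b y * φ k c y * ξ d y * curvature g a b c d y)
        + (∑ b, ∑ d, ξ b y * ξ d y * curvature g i b k d y)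
      = 2 * ((∑ a, covDerivOne g ηL a i y * ∑ b, metricInv g a b y * covDerivOne g ηL b k y)
        + (∑ a, φL a k y * ∑ b, metricInv g a b y * covDerivOne g ηL b i y)
        + (∑ a, φL a i y * ∑ b, metricInv g a b y * covDerivOne g ηL b k y))) := by
  simp only [h.sum_metricInv_mul_covDerivTwo hy hφL, h.sum_metricInv_mul_covDerivOne hy hηL]
  simp only [h.sum_mul_covDerivTwo hy hφL, h.sum_φ_mul hy hφL, h.sum_covDerivOne_mul hy hηL]
  simp only [h.curvature_apply hy, h.covDerivTwo_apply hy hφL, h.covDerivOne_apply hy hηL,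
    hφL y hy, hηL y hy, ← bilinField_basisVec g, ← endField_basisVec φ, ← vecField_apply ξ,
    mul_assoc, ← Finset.mul_sum, sum_mul_trilinear₁, sum_mul_trilinear₂, sum_mul_trilinear₃,
    sum_mul_trilinear₄]
  refine ⟨fun i j k l => ?_, fun j k l => ?_, fun i k => ?_⟩
  · simpa only [mul_assoc] using
      h.curvature_identity hy (basisVec i) (basisVec j) (basisVec k) (basisVec l)
  · have hK := h.curvature_identity_ξ hy (basisVec j) (basisVec k) (basisVec l)
    rw [h.symm y hy _ (endField φ y (basisVec j))]
    simp only [map_add, map_smul, add_apply, smul_apply, smul_eq_mul] at hK ⊢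
    linear_combination hK
  · have hK := h.curvature_identity_ξ_ξ hy (basisVec i) (basisVec k)
    simp only [map_add, map_smul, add_apply, smul_apply, smul_eq_mul,
      h.symm y hy _ (endField φ y (basisVec i))] at hK ⊢
    linear_combination hK

theorem corollary1 (n : ℕ) {M : Type*} [TopologicalSpace M]
    [ChartedSpace (Coord (2 * n + 1)) M] [IsManifold (𝓡 (2 * n + 1)) ∞ M]
    (S : AlmostContactMetricStructure n M) (hS : S.IsContactMetric)
    (e : OpenPartialHomeomorph M (Coord (2 * n + 1)))
    (he : e ∈ IsManifold.maximalAtlas (𝓡 (2 * n + 1)) ∞ M)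
    (y : Coord (2 * n + 1)) (hy : y ∈ e.target) :
    (∀ i j k l : Fin (2 * n + 1),
      S.R e i j k l y
        + (∑ a, ∑ b, ∑ c, ∑ d,
            S.φUp e i a y * S.φUp e j b y * S.φUp e k c y * S.φUp e l d y * S.R e a b c d y)
        + (∑ a, ∑ c, S.φUp e i a y * S.φUp e k c y * S.R e a j c l y)
        + (∑ b, ∑ d, S.φUp e j b y * S.φUp e l d y * S.R e i b k d y)
        - (∑ a, ∑ b, S.φUp e i a y * S.φUp e j b y * S.R e a b k l y)
        - (∑ c, ∑ d, S.φUp e k c y * S.φUp e l d y * S.R e i j c d y)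
        + (∑ a, ∑ d, S.φUp e i a y * S.φUp e l d y * S.R e a j k d y)
        + (∑ b, ∑ c, S.φUp e j b y * S.φUp e k c y * S.R e i b c l y)
        + 4 * S.φLow e i l y * S.φLow e j k y
        - 4 * S.φLow e j l y * S.φLow e i k y
        - 4 * S.gLow e i l y * S.gLow e j k y
        + 4 * S.gLow e j l y * S.gLow e i k y
        + 4 * S.gLow e i l y * S.ηLow e j y * S.ηLow e k y
        + 4 * S.gLow e j k y * S.ηLow e i y * S.ηLow e l y
        - 4 * S.gLow e j l y * S.ηLow e i y * S.ηLow e k y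
        - 4 * S.gLow e i k y * S.ηLow e j y * S.ηLow e l y
      = 2 * (∑ a, S.nablaUpφ e a i j y * S.nablaφ e a k l y)
        + 2 * S.ηLow e k y * S.nablaφ e l i j y
        - 2 * S.ηLow e l y * S.nablaφ e k i j y
        + 2 * S.ηLow e i y * S.nablaφ e j k l y
        - 2 * S.ηLow e j y * S.nablaφ e i k l y) ∧
    (∀ j k l : Fin (2 * n + 1),
      (∑ a, ∑ b, ∑ c, ∑ d,
          S.ξUp e a y * S.φUp e j b y * S.φUp e k c y * S.φUp e l d y * S.R e a b c d y)
        + (∑ a, ∑ c, S.ξUp e a y * S.φUp e k c y * S.R e a j c l y)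
        - (∑ a, ∑ b, S.ξUp e a y * S.φUp e j b y * S.R e a b k l y)
        + (∑ a, ∑ d, S.ξUp e a y * S.φUp e l d y * S.R e a j k d y)
      = 2 * (∑ a, S.nablaUpη e a j y * S.nablaφ e a k l y)
        + 2 * S.ηLow e k y * S.nablaη e l j y
        - 2 * S.ηLow e l y * S.nablaη e k j y
        + 2 * (∑ a, S.φLow e a j y * S.nablaUpφ e a k l y)) ∧
    (∀ i k : Fin (2 * n + 1),
      (∑ a, ∑ b, ∑ c, ∑ d,
          S.φUp e i a y * S.ξUp e b y * S.φUp e k c y * S.ξUp e d y * S.R e a b c d y)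
        + (∑ b, ∑ d, S.ξUp e b y * S.ξUp e d y * S.R e i b k d y)
      = 2 * ((∑ a, S.nablaη e a i y * S.nablaUpη e a k y)
        + (∑ a, S.φLow e a k y * S.nablaUpη e a i y)
        + (∑ a, S.φLow e a i y * S.nablaUpη e a k y))) :=
  corollary1_general (hS.isContactMetricOn he) (fun _ hz => S.φLow_eq he hz)
    (fun _ hz => S.ηLow_eq he hz) hy
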